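/- **Setting.** Let $S\subseteq\mathbb R^n$ be nonempty, convex and compact, let $f:\mathbb R^p\to\overline{\mathbb R}$ and $g:\mathbb R^s\to\overline{\mathbb R}$ be proper, convex and lower semicontinuous, let $A:\mathbb R^n\to\mathbb R^s$ and $K:\mathbb R^n\to\mathbb R^p$ be linear, and let $\varphi:\mathbb R^n\to\mathbb R$ be differentiable with $\ell$-Lipschitz gradient. All spaces carry the Euclidean norm. Put $F(x)=g(Ax)+\varphi(x)-f(Kx)$. Assume that * $A(S)\subseteq\mathrm{ri}(\mathrm{dom}\,g)$, $K(S)\subseteq\mathrm{ri}(\mathrm{dom}\,f)$, $\mathrm{int}(\mathrm{dom}\,f)\ne\emptyset$ and $\inf_{x\in S}F(x)>-\infty$; * for some $r>0$ and $L>0$, the set $\mathcal K_r=\{v:\mathrm{dist}(v,A(S))\le r\}$ is contained in $\mathrm{int}(\mathrm{dom}\,g)$ and $g$ is $L$-Lipschitz on $\mathcal K_r$; * $g$ is essentially strictly convex, i.e. strictly convex on every convex subset of $\mathrm{dom}\,\partial g$. **Algorithm.** Let $0<\alpha<\gamma/2$, $\gamma\le 2r/L$, $\mu>0$, $0<\varepsilon\le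 r$ and $0<\underline\beta\le\beta_k\le\overline\beta<\infty$ for all $k\ge 0$. Let $(a_j)_{j\ge0}$ be a real sequence with $a_0=\alpha+\gamma$, $a_j\ge a_{j+1}>\alpha$, $a_j\to\alpha$, $$\frac{a_j-a_{j+1}}{(a_{j+1}-\alpha)(a_j-\alpha)}\le\frac1\gamma,\qquad (a_j-\alpha)(a_{j+2}-\alpha)\ge(a_{j+1}-\alpha)^2\qquad(j\ge0).$$ Start from $(x^0,y^0,z^0)\in\mathbb R^n\times\mathbb R^p\times\mathbb R^s$ with $\|z^0\|\le L$, and from $\alpha_0=a_0$. For $k\ge 0$ put $\delta_k=\alpha/\alpha_k$, $\rho_k=\frac{\ell}{2}+\frac{3\gamma\|A\|^2}{2(\alpha_k-\alpha)^2}+\mu$ and $$\begin{aligned}x^{k+1}&=\mathrm{Proj}_S\big(x^k+\tfrac1{\rho_k}(-\nabla\varphi(x^k)+K^*y^k-A^*z^k)\big),\\ y^{k+1}&=\mathrm{prox}_{f^*,1/\beta_k}\big(y^k+\tfrac1{\beta_k}Kx^{k+1}\big),\\ z^{k+1}&=\mathrm{prox}_{g^*,1/\alpha_k}\big(\delta_kz^k+\tfrac1{\alpha_k}Ax^{k+1}\big),\end{aligned}$$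 where $f^*,g^*$ are the Fenchel conjugates and $\mathrm{prox}_{h,c}(w)=\mathrm{argmin}_x\{h(x)+\frac1{2c}\|x-w\|^2\}$. If $(\alpha_k-\alpha)\|z^{k+1}\|>\varepsilon$, then $\alpha_{k+1}$ is the next member of the list $(a_j)$ after the one used as $\alpha_k$ (if $\alpha_k$ was taken as $a_j$, then $\alpha_{k+1}=a_{j+1}$); otherwise $\alpha_{k+1}=\alpha_k$, with the same position in the list. **Merit function and KL property.** For $\widetilde\alpha>\alpha$ define on $\mathbb R^n\times\mathbb R^p\times\mathbb R^s\times\mathbb R^s$ $$\varpi(x,y,z,u)=\langle z,Ax\rangle-g^*(z)+\varphi(x)+\iota_S(x)-\langle Kx,y\rangle+f^*(y)+\frac\alpha2\Big(1+\frac{4\alpha}{\widetilde\alpha-\alpha}\Big)\|z-u\|^2-\frac12(\widetilde\alpha-\alpha)\|z\|^2,$$ with value $-\infty$ where $g^*(z)=+\infty$. Let $\partial$ denote the limiting subdifferential. A function $h$ has the KL property at $\hat w\in\mathrm{dom}\,\partial h$ with desingularization function $\phi$ if there are $\eta\in(0,+\infty]$ and an open neighbourhood $U$ of $\hat w$ such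 that $\phi:[0,\eta)\to[0,\infty)$ is continuous and concave with $\phi(0)=0$, $\phi$ is $C^1$ with $\phi'>0$ on $(0,\eta)$, and $\phi'(h(w)-h(\hat w))\,\mathrm{dist}(0,\partial h(w))\ge1$ for all $w\in U$ with $h(\hat w)<h(w)<h(\hat w)+\eta$ (where $\mathrm{dist}(0,\emptyset)=+\infty$). **Theorem.** There exist $K_0\ge0$ and $\widetilde\alpha>\alpha$ such that $\alpha_k=\widetilde\alpha$ and $(\alpha_k-\alpha)\|z^{k+1}\|\le\varepsilon$ for all $k\ge K_0$, and for this $\widetilde\alpha$ the following holds. Let $\theta\in[0,1)$ be such that at every point of $\mathrm{dom}\,\partial\varpi$ the function $\varpi$ has the KL property with desingularization function $\phi(t)=\frac{\sigma}{1-\theta}t^{1-\theta}$ for some $\sigma>0$. Then $(x^k,y^k,z^k)$ converges to some $(\bar x,\bar y,\bar z)$, and 1. if $\theta=0$, then $(x^k,y^k,z^k)=(\bar x,\bar y,\bar z)$ for all sufficiently large $k$; 2. if $\theta\in(0,\frac12]$, then there are $K_1\ge K_0+2$, $q\in(0,1)$ and $\kappa>0$ such that for all $k\ge K_1$ each of $\|x^k-\bar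 x\|$, $\|y^k-\bar y\|$, $\|z^k-\bar z\|$ is at most $\kappa q^k$; 3. if $\theta\in(\frac12,1)$, then there are $K_1\ge K_0+2$ and $\kappa>0$ such that for all $k\ge K_1$ each of $\|x^k-\bar x\|$, $\|y^k-\bar y\|$, $\|z^k-\bar z\|$ is at most $\kappa\,k^{-\frac{1-\theta}{2\theta-1}}$. -/

import Mathlib

open Filter Topology Set
open scoped NNReal ENNReal RealInnerProductSpace

namespace AdaptiveDPFS

noncomputable section

/-! Convex and variational analysis of extended-real-valued functions. -/

section VariationalAnalysis

variable {E : Type*} [NormedAddCommGroup E] [InnerProductSpace ℝ E]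

/-- The effective domain `{x | h x < +∞}`. -/
def effDom (h : E → EReal) : Set E := {x | h x < ⊤}

/-- Proper: nonempty effective domain, and the value `-∞` is never taken. -/
def IsProper (h : E → EReal) : Prop := (effDom h).Nonempty ∧ ∀ x, ⊥ < h x

/-- Convexity of an extended-real-valued function that never takes the value `-∞`. -/
def IsConvexFun (h : E → EReal) : Prop :=
  ∀ x y : E, ∀ a b : ℝ, 0 < a → 0 < b → a + b = 1 →
    h (a • x + b • y) ≤ (a : EReal) * h x + (b : EReal) * h y

/-- The indicator function: `0` on `C` and `+∞` off `C`. -/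
def indicatorFun (C : Set E) (x : E) : EReal :=
  open Classical in if x ∈ C then 0 else ⊤

/-- The Fenchel conjugate `h^*(v) = sup_x (⟨v, x⟩ - h x)`. -/
def conj (h : E → EReal) (v : E) : EReal := ⨆ x : E, ((⟪v, x⟫ : ℝ) : EReal) - h x

/-- The subdifferential of convex analysis. -/
def convexSubdiff (h : E → EReal) (x : E) : Set E :=
  {v | h x ≠ ⊤ ∧ h x ≠ ⊥ ∧ ∀ u : E, h x + ((⟪v, u - x⟫ : ℝ) : EReal) ≤ h u}

/-- Essential strict convexity: strict convexity on every convex subset of the domain of the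
convex subdifferential (`h` is finite there). -/
def IsEssStrictlyConvex (h : E → EReal) : Prop :=
  ∀ C : Set E, C.Nonempty → Convex ℝ C → (∀ x ∈ C, (convexSubdiff h x).Nonempty) →
    StrictConvexOn ℝ C (fun x => (h x).toReal)

/-- The Fréchet subdifferential; the inequality says that
`liminf_{u → x, u ≠ x} (h u - h x - ⟨v, u - x⟩) / ‖u - x‖ ≥ 0`. -/
def frechetSubdiff (h : E → EReal) (x : E) : Set E :=
  {v | h x ≠ ⊤ ∧ h x ≠ ⊥ ∧ ∀ ε : ℝ, 0 < ε → ∀ᶠ u in 𝓝 x,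
    h x + ((⟪v, u - x⟫ - ε * ‖u - x‖ : ℝ) : EReal) ≤ h u}

/-- The limiting subdifferential. -/
def limitingSubdiff (h : E → EReal) (x : E) : Set E :=
  {v | h x ≠ ⊤ ∧ h x ≠ ⊥ ∧ ∃ xs vs : ℕ → E,
    Tendsto xs atTop (𝓝 x) ∧ Tendsto (fun k => h (xs k)) atTop (𝓝 (h x)) ∧
    Tendsto vs atTop (𝓝 v) ∧ ∀ k, vs k ∈ frechetSubdiff h (xs k)}

/-- The requirements on a desingularization function `phi : [0, η) → [0, +∞)`, `η ∈ (0, +∞]`. -/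
structure IsDesingularizer (η : EReal) (phi : ℝ → ℝ) : Prop where
  concave : ConcaveOn ℝ {t : ℝ | 0 ≤ t ∧ (t : EReal) < η} phi
  continuousOn : ContinuousOn phi {t : ℝ | 0 ≤ t ∧ (t : EReal) < η}
  nonneg : ∀ t : ℝ, 0 ≤ t → (t : EReal) < η → 0 ≤ phi t
  map_zero : phi 0 = 0
  contDiffOn : ContDiffOn ℝ 1 phi {t : ℝ | 0 < t ∧ (t : EReal) < η}
  deriv_pos : ∀ t : ℝ, 0 < t → (t : EReal) < η → 0 < deriv phi t

/-- The Kurdyka–Łojasiewicz property of `h` at `x₀` with desingularization function `phi`.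
The distance to the empty set is `+∞`. -/
def HasKLWith (h : E → EReal) (x₀ : E) (phi : ℝ → ℝ) : Prop :=
  ∃ η : EReal, 0 < η ∧ IsDesingularizer η phi ∧ ∃ U : Set E, IsOpen U ∧ x₀ ∈ U ∧
    ∀ x ∈ U, h x₀ < h x → h x < h x₀ + η →
      1 ≤ ENNReal.ofReal (deriv phi ((h x).toReal - (h x₀).toReal)) *
        Metric.infEDist (0 : E) (limitingSubdiff h x)

/-- `u` is the proximal point `argmin_x (h x + ‖x - w‖² / (2 c))`. -/
def IsProx (h : E → EReal) (c : ℝ) (w u : E) : Prop :=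
  ∀ x : E, h u + ((1 / (2 * c) * ‖u - w‖ ^ 2 : ℝ) : EReal)
    ≤ h x + ((1 / (2 * c) * ‖x - w‖ ^ 2 : ℝ) : EReal)

/-- `u` is the projection of `w` onto `C`. -/
def IsProj (C : Set E) (w u : E) : Prop := u ∈ C ∧ ∀ c ∈ C, ‖u - w‖ ≤ ‖c - w‖

end VariationalAnalysis

/-! The structured DC program and the algorithm. -/

/-- Data of the program `min_{x ∈ S} g (A x) + phi x - f (K x)`. -/
structure DCProgram (n p s : ℕ) where
  S : Set (EuclideanSpace ℝ (Fin n))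
  f : EuclideanSpace ℝ (Fin p) → EReal
  g : EuclideanSpace ℝ (Fin s) → EReal
  phi : EuclideanSpace ℝ (Fin n) → ℝ
  A : EuclideanSpace ℝ (Fin n) →L[ℝ] EuclideanSpace ℝ (Fin s)
  K : EuclideanSpace ℝ (Fin n) →L[ℝ] EuclideanSpace ℝ (Fin p)

/-- The space `ℝⁿ × ℝᵖ × ℝˢ × ℝˢ` with its Euclidean structure. -/
abbrev Space4 (n p s : ℕ) : Type :=
  WithLp 2 (EuclideanSpace ℝ (Fin n) × WithLp 2 (EuclideanSpace ℝ (Fin p) ×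
    WithLp 2 (EuclideanSpace ℝ (Fin s) × EuclideanSpace ℝ (Fin s))))

namespace DCProgram

variable {n p s : ℕ} (P : DCProgram n p s)

/-- The objective `F`. -/
def objective (x : EuclideanSpace ℝ (Fin n)) : EReal :=
  P.g (P.A x) + (P.phi x : EReal) - P.f (P.K x)

/-- The enlargement `{z | dist (z, A(S)) ≤ r}`. -/
def enlargement (r : ℝ) : Set (EuclideanSpace ℝ (Fin s)) :=
  {z | Metric.infDist z (P.A '' P.S) ≤ r}

/-- `Ψ(x, y, z) = ⟨z, A x⟩ - g^*(z) + phi x + ι_S(x) - ⟨K x, y⟩ + f^*(y)`. -/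
def Psi (x : EuclideanSpace ℝ (Fin n)) (y : EuclideanSpace ℝ (Fin p))
    (z : EuclideanSpace ℝ (Fin s)) : EReal :=
  ((⟪z, P.A x⟫ : ℝ) : EReal) - conj P.g z + (P.phi x : EReal) + indicatorFun P.S x
    - ((⟪P.K x, y⟫ : ℝ) : EReal) + conj P.f y

/-- The merit function `ϖ(x, y, z, u)`, where `αfin` is the final value of the parameters `α_k`. -/
def merit (α αfin : ℝ) (w : Space4 n p s) : EReal :=
  P.Psi w.fst w.snd.fst w.snd.snd.fst
    + ((α / 2 * (1 + 4 * α / (αfin - α)) * ‖w.snd.snd.fst - w.snd.snd.snd‖ ^ 2 : ℝ) : EReal)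
    - ((1 / 2 * (αfin - α) * ‖w.snd.snd.fst‖ ^ 2 : ℝ) : EReal)

end DCProgram

/-- The list of values, from `α + γ` down to `α`, through which the parameters `α_k` may pass. -/
structure IsParameterList (α γ : ℝ) (a : ℕ → ℝ) : Prop where
  tendsto : Tendsto a atTop (𝓝 α)
  zero : a 0 = α + γ
  anti : ∀ j, a (j + 1) ≤ a j
  gt : ∀ j, α < a j
  increment : ∀ j, (a j - a (j + 1)) / ((a (j + 1) - α) * (a j - α)) ≤ 1 / γ
  logConvex : ∀ j, (a (j + 1) - α) ^ 2 ≤ (a j - α) * (a (j + 2) - α)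

/-- The sequence `(x k, y k, z k)` is generated by the adaptive double proximal full splitting
algorithm. The parameter `α_k` moves to the next value of the list `a` exactly when
`(α_k - α) ‖z (k+1)‖ > ε` and stays unchanged otherwise; `m k` counts the moves made so far. -/
structure IsAdaptiveDPFS {n p s : ℕ} (P : DCProgram n p s) (ℓ α γ μ ε : ℝ) (a : ℕ → ℝ)
    (αs βs ρs δs : ℕ → ℝ) (x : ℕ → EuclideanSpace ℝ (Fin n))
    (y : ℕ → EuclideanSpace ℝ (Fin p)) (z : ℕ → EuclideanSpace ℝ (Fin s)) : Prop where
  x_step : ∀ k, IsProj P.S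
    (x k + (1 / ρs k) • (-gradient P.phi (x k) + ContinuousLinearMap.adjoint P.K (y k)
      - ContinuousLinearMap.adjoint P.A (z k))) (x (k + 1))
  y_step : ∀ k, IsProx (conj P.f) (1 / βs k) (y k + (1 / βs k) • P.K (x (k + 1))) (y (k + 1))
  z_step : ∀ k, IsProx (conj P.g) (1 / αs k)
    (δs k • z k + (1 / αs k) • P.A (x (k + 1))) (z (k + 1))
  α_rule : ∃ m : ℕ → ℕ, m 0 = 0 ∧ (∀ k, αs k = a (m k)) ∧
    (∀ k, ε < (αs k - α) * ‖z (k + 1)‖ → m (k + 1) = m k + 1) ∧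
    (∀ k, (αs k - α) * ‖z (k + 1)‖ ≤ ε → m (k + 1) = m k)
  ρ_rule : ∀ k, ρs k = ℓ / 2 + 3 * γ * ‖P.A‖ ^ 2 / (2 * (αs k - α) ^ 2) + μ
  δ_rule : ∀ k, δs k = α / αs k

end

end AdaptiveDPFS

open AdaptiveDPFS

/-!
The proof is a Kurdyka–Łojasiewicz argument for the merit function `ϖ` along the points
`w k = (x k, y k, z k, z (k - 1))`.

*The parameters settle.* `z (k+1)` is a subgradient of `g` at `A x + α z - α_k z (k+1)`, a point
that may lie far from `A (S)`. Convexity compares it with `A x + α z`, around which `g` is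
`L`-Lipschitz because `α L < r`; hence `‖z k‖ ≤ L` for all `k` (`norm_le_of_mem_convexSubdiff`).
As `a_j → α`, the condition for moving along the list eventually fails, and `α_k` is constant from
then on (`IsAdaptiveDPFS.exists_final_parameter`).

*Sufficient decrease.* With `c = αfin - α`, the `z`-step increases `ϖ` by a quantity involving
`‖A (x (k+1) - x k)‖` and two consecutive differences of `z`. Monotonicity of `∂g^*` at two
consecutive dual iterates bounds it by the decrease in the `x`-step and the difference of the
coupling terms in `ϖ` (`coupling_estimate`, `realMerit_step_le`).

*Subgradients.* The function `-g^*` is concave, but `g^*` is differentiable wherever it has a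
subgradient: by essential strict convexity `g - ⟨z, ·⟩` has a unique minimizer `ξ`, by compactness
of spheres it grows at least linearly away from `ξ`, and taking the supremum in the definition of
`g^*` gives the first-order estimate (`eventually_conj_le`). So the optimality conditions of the
three steps produce Fréchet subgradients of `ϖ` at `w (k+1)` of size `O(‖w (k+1) - w k‖)`
(`exists_frechetSubdiff_norm_le`). The passage from `ξ ∈ ∂g^*(z)` to `z ∈ ∂g(ξ)` uses only the
existence of proximal points and monotonicity (`mem_convexSubdiff_of_conj`).

*Convergence.* The iterates are bounded: in `y` because `f^*(y) - ⟨K x, y⟩` is coercive uniformly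
in `x ∈ S` (`exists_conj_coercive`). Subdifferentials of convex functions have closed graph, with
convergence of values, so at each cluster point `ϖ` takes the limiting value and has a
subgradient; the Kurdyka–Łojasiewicz property at the cluster points then gives one Łojasiewicz
inequality along the sequence (`IsFixedParameterRun.exists_lojasiewicz_constant`). The rest
concerns real sequences: the energies satisfy `E (k+1) ^ (2θ) ≤ B (E k - E (k+1))`, and the
remaining length of the trajectory is at most a multiple of `E (k-1) ^ min (1/2) (1-θ)`
(`exists_tail_bound`).
-/

namespace AdaptiveDPFS

/-! ### Extended-real-valued convex functions -/

section Convex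

variable {E : Type*} [NormedAddCommGroup E] [InnerProductSpace ℝ E] {h : E → EReal}

theorem eq_top_or_exists_coe {a : EReal} (ha : ⊥ < a) : a = ⊤ ∨ ∃ b : ℝ, a = b := by
  induction a with
  | bot => exact absurd ha (lt_irrefl _)
  | coe b => exact Or.inr ⟨b, rfl⟩
  | top => exact Or.inl rfl

theorem exists_coe_of_lt_top {X : Type*} {f : X → EReal} (hb : ∀ x, ⊥ < f x) {x : X}
    (hx : f x < ⊤) : ∃ a : ℝ, f x = a :=
  (eq_top_or_exists_coe (hb x)).resolve_left hx.ne

theorem exists_coe_of_mem_convexSubdiff {x v : E} (hv : v ∈ convexSubdiff h x) :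
    ∃ a : ℝ, h x = a :=
  (eq_top_or_exists_coe (bot_lt_iff_ne_bot.2 hv.2.1)).resolve_left hv.1

theorem mem_convexSubdiff_iff (hb : ∀ x, ⊥ < h x) {x v : E} {a : ℝ} (hx : h x = a) :
    v ∈ convexSubdiff h x ↔ ∀ (u : E) (b : ℝ), h u = b → a + ⟪v, u - x⟫ ≤ b := by
  constructor
  · rintro ⟨-, -, hv⟩ u b hu
    have := hv u
    rw [hx, hu] at this
    exact_mod_cast this
  · intro H
    refine ⟨by simp [hx], by simp [hx], fun u => ?_⟩
    rcases eq_top_or_exists_coe (hb u) with hu | ⟨b, hu⟩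
    · simp [hu]
    · rw [hx, hu]
      exact_mod_cast H u b hu

theorem subgradient_ineq {x v u : E} (hv : v ∈ convexSubdiff h x) {a b : ℝ} (hx : h x = a)
    (hu : h u = b) : a + ⟪v, u - x⟫ ≤ b := by
  have := hv.2.2 u
  rw [hx, hu] at this
  exact_mod_cast this

/-- The convex subdifferential is a monotone operator. -/
theorem convexSubdiff_monotone {x y v w : E} (hv : v ∈ convexSubdiff h x)
    (hw : w ∈ convexSubdiff h y) : 0 ≤ ⟪v - w, x - y⟫ := by
  obtain ⟨a, ha⟩ := exists_coe_of_mem_convexSubdiff hv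
  obtain ⟨b, hb⟩ := exists_coe_of_mem_convexSubdiff hw
  have h1 := subgradient_ineq hv ha hb
  have h2 := subgradient_ineq hw hb ha
  rw [← neg_sub x y, inner_neg_right] at h1
  rw [inner_sub_left]
  linarith

theorem IsConvexFun.exists_coe_le (hc : IsConvexFun h) (hb : ∀ x, ⊥ < h x) {x y : E} {a b : ℝ}
    (hx : h x = a) (hy : h y = b) {s t : ℝ} (hs : 0 ≤ s) (ht : 0 ≤ t) (hst : s + t = 1) :
    ∃ c : ℝ, h (s • x + t • y) = c ∧ c ≤ s * a + t * b := by
  rcases hs.eq_or_lt with rfl | hs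
  · obtain rfl : t = 1 := by linarith
    exact ⟨b, by simpa using hy, by simp⟩
  rcases ht.eq_or_lt with rfl | ht
  · obtain rfl : s = 1 := by linarith
    exact ⟨a, by simpa using hx, by simp⟩
  have := hc x y s t hs ht hst
  rw [hx, hy] at this
  have this' : h (s • x + t • y) ≤ ((s * a + t * b : ℝ) : EReal) := by exact_mod_cast this
  rcases eq_top_or_exists_coe (hb (s • x + t • y)) with h1 | ⟨c, h1⟩
  · rw [h1] at this'
    exact absurd (top_le_iff.1 this') (EReal.coe_ne_top _)
  · rw [h1] at this'
    exact ⟨c, h1, by exact_mod_cast this'⟩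

/-! ### Fenchel conjugates -/

theorem conj_le_coe_iff (hb : ∀ x, ⊥ < h x) {v : E} {c : ℝ} :
    conj h v ≤ c ↔ ∀ (x : E) (b : ℝ), h x = b → ⟪v, x⟫ - b ≤ c := by
  rw [conj, iSup_le_iff]
  constructor
  · intro H x b hx
    have := H x
    rw [hx] at this
    exact_mod_cast this
  · intro H x
    rcases eq_top_or_exists_coe (hb x) with hx | ⟨b, hx⟩
    · simp [hx]
    · rw [hx]
      exact_mod_cast H x b hx

theorem coe_le_conj {x v : E} {b : ℝ} (hx : h x = b) : ((⟪v, x⟫ - b : ℝ) : EReal) ≤ conj h v := by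
  have := le_iSup (fun x : E => ((⟪v, x⟫ : ℝ) : EReal) - h x) x
  rw [hx] at this
  exact_mod_cast this

theorem bot_lt_conj (hp : IsProper h) (v : E) : ⊥ < conj h v := by
  obtain ⟨x, hx⟩ := hp.1
  obtain ⟨b, hb⟩ := exists_coe_of_lt_top hp.2 hx
  exact (EReal.bot_lt_coe _).trans_le (coe_le_conj hb)

theorem isConvexFun_conj (hp : IsProper h) : IsConvexFun (conj h) := by
  intro v w s t hs ht hst
  rcases eq_top_or_exists_coe (bot_lt_conj hp v) with hv | ⟨a, hv⟩
  · rw [hv, EReal.coe_mul_top_of_pos hs, EReal.top_add_of_ne_bot]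
    · exact le_top
    · rcases eq_top_or_exists_coe (bot_lt_conj hp w) with hw | ⟨b, hw⟩
      · simp [hw, EReal.coe_mul_top_of_pos ht]
      · rw [hw, ← EReal.coe_mul]
        exact EReal.coe_ne_bot _
  rcases eq_top_or_exists_coe (bot_lt_conj hp w) with hw | ⟨b, hw⟩
  · rw [hw, EReal.coe_mul_top_of_pos ht, hv, ← EReal.coe_mul, EReal.coe_add_top]
    exact le_top
  rw [hv, hw]
  have h1 := (conj_le_coe_iff hp.2).1 hv.le
  have h2 := (conj_le_coe_iff hp.2).1 hw.le
  have : conj h (s • v + t • w) ≤ ((s * a + t * b : ℝ) : EReal) := by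
    refine (conj_le_coe_iff hp.2).2 fun x c hx => ?_
    have e1 := mul_le_mul_of_nonneg_left (h1 x c hx) hs.le
    have e2 := mul_le_mul_of_nonneg_left (h2 x c hx) ht.le
    have e3 : c = s * c + t * c := by rw [← add_mul, hst, one_mul]
    rw [inner_add_left, real_inner_smul_left, real_inner_smul_left]
    linarith
  exact_mod_cast this

theorem lowerSemicontinuous_conj (hb : ∀ x, ⊥ < h x) : LowerSemicontinuous (conj h) := by
  refine lowerSemicontinuous_iSup fun x => Continuous.lowerSemicontinuous ?_
  rcases eq_top_or_exists_coe (hb x) with hx | ⟨b, hx⟩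
  · simp only [hx, EReal.sub_top]
    exact continuous_const
  · simp only [hx, ← EReal.coe_sub]
    exact continuous_coe_real_ereal.comp (by fun_prop)

theorem conj_eq_of_mem_convexSubdiff (hb : ∀ x, ⊥ < h x) {x v : E} (hv : v ∈ convexSubdiff h x)
    {a : ℝ} (hx : h x = a) : conj h v = ((⟪v, x⟫ - a : ℝ) : EReal) := by
  refine le_antisymm ((conj_le_coe_iff hb).2 fun u b hu => ?_) (coe_le_conj hx)
  have := subgradient_ineq hv hx hu
  rw [inner_sub_right] at this
  linarith

theorem mem_convexSubdiff_conj (hp : IsProper h) {x v : E} (hv : v ∈ convexSubdiff h x) :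
    x ∈ convexSubdiff (conj h) v := by
  obtain ⟨a, hx⟩ := exists_coe_of_mem_convexSubdiff hv
  refine (mem_convexSubdiff_iff (bot_lt_conj hp) (conj_eq_of_mem_convexSubdiff hp.2 hv hx)).2
    fun u b hu => ?_
  have := (conj_le_coe_iff hp.2).1 hu.le x a hx
  rw [inner_sub_right, real_inner_comm u x, real_inner_comm v x]
  linarith

/-! ### Proximal points -/

/-- Optimality condition for proximal points. -/
theorem IsProx.mem_convexSubdiff (hc : IsConvexFun h) (hp : IsProper h) {c : ℝ} (hc0 : 0 < c)
    {w u : E} (hu : IsProx h c w u) : (1 / c) • (w - u) ∈ convexSubdiff h u := by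
  obtain ⟨x₀, hx₀⟩ := hp.1
  obtain ⟨b₀, hb₀⟩ := exists_coe_of_lt_top hp.2 hx₀
  obtain ⟨a, ha⟩ : ∃ a : ℝ, h u = a := by
    refine (eq_top_or_exists_coe (hp.2 u)).resolve_left fun hu' => ?_
    have := hu x₀
    rw [hu', hb₀, EReal.top_add_coe, ← EReal.coe_add] at this
    exact absurd (top_le_iff.1 this) (EReal.coe_ne_top _)
  refine (mem_convexSubdiff_iff hp.2 ha).2 fun x b hx => ?_
  have key : ∀ t : ℝ, 0 < t → t ≤ 1 →
      a + ⟪(1 / c) • (w - u), x - u⟫ - b ≤ t * (1 / (2 * c) * ‖x - u‖ ^ 2) := by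
    intro t ht ht1
    obtain ⟨d, hd, hd'⟩ := hc.exists_coe_le hp.2 ha hx (sub_nonneg.2 ht1) ht.le (by ring)
    have := hu ((1 - t) • u + t • x)
    rw [ha, hd] at this
    have h2 : a + 1 / (2 * c) * ‖u - w‖ ^ 2 ≤
        d + 1 / (2 * c) * ‖(1 - t) • u + t • x - w‖ ^ 2 := by exact_mod_cast this
    have e : (1 - t) • u + t • x - w = (u - w) + t • (x - u) := by module
    have e2 : ⟪u - w, x - u⟫ = -⟪w - u, x - u⟫ := by rw [← neg_sub w u, inner_neg_left]
    rw [e, norm_add_sq_real, real_inner_smul_right, norm_smul, mul_pow, Real.norm_eq_abs, sq_abs,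
      e2] at h2
    rw [real_inner_smul_left]
    refine le_of_mul_le_mul_left ?_ ht
    have e3 : 1 / c = 2 * (1 / (2 * c)) := by field_simp
    rw [e3]
    nlinarith
  have hlim : Tendsto (fun t : ℝ => t * (1 / (2 * c) * ‖x - u‖ ^ 2)) (𝓝[>] 0) (𝓝 0) := by
    have : Tendsto (fun t : ℝ => t * (1 / (2 * c) * ‖x - u‖ ^ 2)) (𝓝 0)
        (𝓝 (0 * (1 / (2 * c) * ‖x - u‖ ^ 2))) := by
      exact (continuous_id.mul continuous_const).tendsto 0
    rw [zero_mul] at this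
    exact this.mono_left nhdsWithin_le_nhds
  have := ge_of_tendsto hlim (by
    filter_upwards [Ioc_mem_nhdsGT (zero_lt_one' ℝ)] with t ht using key t ht.1 ht.2)
  linarith

/-- A proper convex lower semicontinuous function decreases at most linearly. -/
theorem exists_linear_lower_bound [FiniteDimensional ℝ E] (hc : IsConvexFun h) (hp : IsProper h)
    (hl : LowerSemicontinuous h) :
    ∃ (x₀ : E) (a M : ℝ), 0 ≤ M ∧ h x₀ = a ∧
      ∀ (u : E) (b : ℝ), h u = b → a - M * (1 + ‖u - x₀‖) ≤ b := by
  obtain ⟨x₀, hx₀⟩ := hp.1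
  obtain ⟨a, ha⟩ := exists_coe_of_lt_top hp.2 hx₀
  obtain ⟨q, hq, hmin⟩ := LowerSemicontinuousOn.exists_isMinOn
    (Metric.nonempty_closedBall.2 (zero_le_one' ℝ)) (isCompact_closedBall x₀ (1 : ℝ))
    (hl.lowerSemicontinuousOn _)
  have hqa : h q ≤ a := ha ▸ hmin (Metric.mem_closedBall_self zero_le_one)
  obtain ⟨m, hm⟩ : ∃ m : ℝ, h q = m :=
    exists_coe_of_lt_top hp.2 (hqa.trans_lt (EReal.coe_lt_top a))
  have hma : m ≤ a := by rw [hm] at hqa; exact_mod_cast hqa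
  refine ⟨x₀, a, a - m, sub_nonneg.2 hma, ha, fun u b hu => ?_⟩
  rcases le_or_gt ‖u - x₀‖ 1 with h1 | h1
  · have : h q ≤ h u := hmin (by rwa [Metric.mem_closedBall, dist_eq_norm])
    rw [hm, hu] at this
    have : m ≤ b := by exact_mod_cast this
    nlinarith [norm_nonneg (u - x₀), sub_nonneg.2 hma]
  · have hR : 0 < ‖u - x₀‖ := by linarith
    have hR1 : ‖u - x₀‖⁻¹ ≤ 1 := inv_le_one_of_one_le₀ h1.le
    obtain ⟨d, hd, hd'⟩ := hc.exists_coe_le hp.2 ha hu (sub_nonneg.2 hR1) (inv_nonneg.2 hR.le)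
      (by ring)
    have : h q ≤ h ((1 - ‖u - x₀‖⁻¹) • x₀ + ‖u - x₀‖⁻¹ • u) := by
      refine hmin ?_
      have e : (1 - ‖u - x₀‖⁻¹) • x₀ + ‖u - x₀‖⁻¹ • u - x₀ = ‖u - x₀‖⁻¹ • (u - x₀) := by module
      rw [Metric.mem_closedBall, dist_eq_norm, e, norm_smul, norm_inv, norm_norm,
        inv_mul_cancel₀ hR.ne']
    rw [hm, hd] at this
    have : m ≤ d := by exact_mod_cast this
    have h3 := mul_le_mul_of_nonneg_left (this.trans hd') hR.le
    have e : ‖u - x₀‖ * ((1 - ‖u - x₀‖⁻¹) * a + ‖u - x₀‖⁻¹ * b) = (‖u - x₀‖ - 1) * a + b := by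
      field_simp
    rw [e] at h3
    nlinarith

theorem exists_isProx [FiniteDimensional ℝ E] (hc : IsConvexFun h) (hp : IsProper h)
    (hl : LowerSemicontinuous h) (w : E) : ∃ u, IsProx h 1 w u := by
  obtain ⟨x₀, a, M, hM, ha, hlow⟩ := exists_linear_lower_bound hc hp hl
  have hlsc : LowerSemicontinuous
      (fun u => h u + ((1 / (2 * 1) * ‖u - w‖ ^ 2 : ℝ) : EReal)) := by
    refine hl.add' (Continuous.lowerSemicontinuous
      (continuous_coe_real_ereal.comp (by fun_prop))) fun x => ?_
    exact EReal.continuousAt_add (Or.inr (EReal.coe_ne_bot _)) (Or.inl (hp.2 x).ne')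
  -- Outside this ball the objective exceeds its value at the centre.
  have hT : 0 ≤ 2 * ‖x₀ - w‖ + 2 * M + 2 := by positivity
  obtain ⟨u, -, hmin⟩ := LowerSemicontinuousOn.exists_isMinOn
    (Metric.nonempty_closedBall.2 hT)
    (isCompact_closedBall x₀ (2 * ‖x₀ - w‖ + 2 * M + 2)) (hlsc.lowerSemicontinuousOn _)
  refine ⟨u, fun x => ?_⟩
  by_cases hx : x ∈ Metric.closedBall x₀ (2 * ‖x₀ - w‖ + 2 * M + 2)
  · exact hmin hx
  · refine (hmin (Metric.mem_closedBall_self hT)).trans ?_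
    rw [Metric.mem_closedBall, dist_eq_norm, not_le] at hx
    rcases eq_top_or_exists_coe (hp.2 x) with hx' | ⟨b, hx'⟩
    · rw [hx', EReal.top_add_coe]; exact le_top
    · have h1 := hlow x b hx'
      simp only [ha, hx']
      have h2 : ‖x - x₀‖ ≤ ‖x - w‖ + ‖x₀ - w‖ := by
        have : x - x₀ = (x - w) - (x₀ - w) := by abel
        rw [this]; exact norm_sub_le _ _
      have h3 : a + 1 / (2 * 1) * ‖x₀ - w‖ ^ 2 ≤ b + 1 / (2 * 1) * ‖x - w‖ ^ 2 := by
        have h4 : (‖x - x₀‖ - ‖x₀ - w‖) ^ 2 ≤ ‖x - w‖ ^ 2 := by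
          refine pow_le_pow_left₀ ?_ (by linarith) 2
          linarith [norm_nonneg (x₀ - w)]
        have h5 : ‖x - x₀‖ * (2 * ‖x₀ - w‖ + 2 * M + 2) ≤ ‖x - x₀‖ * ‖x - x₀‖ :=
          mul_le_mul_of_nonneg_left hx.le (norm_nonneg _)
        nlinarith [norm_nonneg (x₀ - w)]
      exact_mod_cast h3

/-- A resolvent point: the equation `w = u + v` with `v` a subgradient at `u` is solvable for
every `w`, that is, the subdifferential is a maximal monotone operator. -/
theorem exists_sub_mem_convexSubdiff [FiniteDimensional ℝ E] (hc : IsConvexFun h)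
    (hp : IsProper h) (hl : LowerSemicontinuous h) (w : E) : ∃ u, w - u ∈ convexSubdiff h u := by
  obtain ⟨u, hu⟩ := exists_isProx hc hp hl w
  exact ⟨u, by simpa using hu.mem_convexSubdiff hc hp one_pos⟩

theorem isProper_conj [FiniteDimensional ℝ E] (hc : IsConvexFun h) (hp : IsProper h)
    (hl : LowerSemicontinuous h) : IsProper (conj h) := by
  obtain ⟨u, hu⟩ := exists_sub_mem_convexSubdiff hc hp hl 0
  obtain ⟨a, ha⟩ := exists_coe_of_mem_convexSubdiff hu
  refine ⟨⟨0 - u, ?_⟩, bot_lt_conj hp⟩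
  rw [effDom, mem_ofPred_eq, conj_eq_of_mem_convexSubdiff hp.2 hu ha]
  exact EReal.coe_lt_top _

/-- Subgradients of the conjugate invert subgradients of the function. By maximal monotonicity
there is `q` with `x + v - q ∈ ∂h q`, and monotonicity of `∂h^*` forces `q = x`. -/
theorem mem_convexSubdiff_of_conj [FiniteDimensional ℝ E] (hc : IsConvexFun h)
    (hp : IsProper h) (hl : LowerSemicontinuous h) {x v : E}
    (hx : x ∈ convexSubdiff (conj h) v) : v ∈ convexSubdiff h x := by
  obtain ⟨q, hq⟩ := exists_sub_mem_convexSubdiff hc hp hl (x + v)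
  have h1 := convexSubdiff_monotone (mem_convexSubdiff_conj hp hq) hx
  have e : x + v - q - v = -(q - x) := by abel
  rw [e, inner_neg_right, real_inner_self_eq_norm_sq] at h1
  have h2 : q - x = 0 := by
    have : ‖q - x‖ ^ 2 = 0 := le_antisymm (by linarith) (by positivity)
    simpa using this
  obtain rfl : q = x := sub_eq_zero.1 h2
  simpa using hq

/-! ### Essential strict convexity and differentiability of the conjugate -/

/-- For an essentially strictly convex function a vector is a subgradient at no more than one
point: otherwise the function is affine on the segment between two such points. -/
theorem IsEssStrictlyConvex.eq_of_mem_convexSubdiff (hs : IsEssStrictlyConvex h)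
    (hc : IsConvexFun h) (hb : ∀ x, ⊥ < h x) {x y v : E} (hx : v ∈ convexSubdiff h x)
    (hy : v ∈ convexSubdiff h y) : x = y := by
  obtain ⟨a, ha⟩ := exists_coe_of_mem_convexSubdiff hx
  obtain ⟨b, hb'⟩ := exists_coe_of_mem_convexSubdiff hy
  by_contra hne
  have hseg : ∀ q ∈ segment ℝ x y, (convexSubdiff h q).Nonempty := by
    rintro q ⟨s, t, hs0, ht0, hst, rfl⟩
    obtain ⟨d, hd, hd'⟩ := hc.exists_coe_le hb ha hb' hs0 ht0 hst
    refine ⟨v, (mem_convexSubdiff_iff hb hd).2 fun u c hu => ?_⟩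
    have h1 := mul_le_mul_of_nonneg_left (subgradient_ineq hx ha hu) hs0
    have h2 := mul_le_mul_of_nonneg_left (subgradient_ineq hy hb' hu) ht0
    have e : u - (s • x + t • y) = s • (u - x) + t • (u - y) := by
      have : u = s • u + t • u := by rw [← add_smul, hst, one_smul]
      rw [smul_sub, smul_sub]
      nth_rewrite 1 [this]
      abel
    have e2 : c = s * c + t * c := by rw [← add_mul, hst, one_mul]
    rw [e, inner_add_right, real_inner_smul_right, real_inner_smul_right]
    linarith
  have hstrict := hs (segment ℝ x y) ⟨x, left_mem_segment ℝ x y⟩ (convex_segment x y) hseg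
  have h3 := hstrict.2 (left_mem_segment ℝ x y) (right_mem_segment ℝ x y) hne
    (by norm_num : (0 : ℝ) < 1 / 2) (by norm_num : (0 : ℝ) < 1 / 2) (by norm_num)
  obtain ⟨d, hd, -⟩ := hc.exists_coe_le hb ha hb' (by norm_num : (0 : ℝ) ≤ 1 / 2)
    (by norm_num : (0 : ℝ) ≤ 1 / 2) (by norm_num)
  simp only [hd, ha, hb', EReal.toReal_coe, smul_eq_mul] at h3
  have h1 := subgradient_ineq hx ha hd
  have h2 := subgradient_ineq hy hb' hd
  have e1 : (1 / 2 : ℝ) • x + (1 / 2 : ℝ) • y - x = (1 / 2 : ℝ) • (y - x) := by module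
  have e2 : (1 / 2 : ℝ) • x + (1 / 2 : ℝ) • y - y = (-(1 / 2) : ℝ) • (y - x) := by module
  rw [e1, real_inner_smul_right] at h1
  rw [e2, real_inner_smul_right] at h2
  linarith

/-- A unique minimizer of a convex lower semicontinuous function is sharp at every positive
distance; here the function is `h - ⟨v, ·⟩`. -/
theorem exists_growth_of_unique_subgradient [FiniteDimensional ℝ E] (hc : IsConvexFun h)
    (hb : ∀ x, ⊥ < h x) (hl : LowerSemicontinuous h) {x v : E} (hv : v ∈ convexSubdiff h x)
    (huniq : ∀ y, v ∈ convexSubdiff h y → y = x) {a : ℝ} (ha : h x = a) {ε : ℝ} (hε : 0 < ε) :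
    ∃ δ : ℝ, 0 < δ ∧ ∀ (u : E) (b : ℝ), h u = b → ε ≤ ‖u - x‖ →
      a + ⟪v, u - x⟫ + δ * ‖u - x‖ ≤ b := by
  obtain ⟨δ, hδ, hsph⟩ : ∃ δ : ℝ, 0 < δ ∧ ∀ (u : E) (b : ℝ), h u = b → ‖u - x‖ = ε →
      a + ⟪v, u - x⟫ + δ * ε ≤ b := by
    rcases (Metric.sphere x ε).eq_empty_or_nonempty with hemp | hne
    · refine ⟨1, one_pos, fun u b _ hu => ?_⟩
      have : u ∈ Metric.sphere x ε := by rwa [mem_sphere_iff_norm]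
      rw [hemp] at this
      exact absurd this (notMem_empty u)
    have hlsc : LowerSemicontinuous (fun u => h u + ((-⟪v, u - x⟫ : ℝ) : EReal)) := by
      refine hl.add' (Continuous.lowerSemicontinuous
        (continuous_coe_real_ereal.comp (by fun_prop))) fun x => ?_
      exact EReal.continuousAt_add (Or.inr (EReal.coe_ne_bot _)) (Or.inl (hb x).ne')
    obtain ⟨q, hq, hmin⟩ := LowerSemicontinuousOn.exists_isMinOn hne (isCompact_sphere x ε)
      (hlsc.lowerSemicontinuousOn _)
    rw [mem_sphere_iff_norm] at hq
    rcases eq_top_or_exists_coe (hb q) with hqt | ⟨d, hd⟩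
    · refine ⟨1, one_pos, fun u b hu hu' => ?_⟩
      have h1 := hmin (show u ∈ Metric.sphere x ε by rwa [mem_sphere_iff_norm])
      simp only [mem_ofPred_eq, hqt, EReal.top_add_coe, hu] at h1
      rw [← EReal.coe_add] at h1
      exact absurd (top_le_iff.1 h1) (EReal.coe_ne_top _)
    have hpos : a < d - ⟪v, q - x⟫ := by
      by_contra hcon
      have hqx : q = x := huniq q ((mem_convexSubdiff_iff hb hd).2 fun u b hu => by
        have h1 := subgradient_ineq hv ha hu
        have e : u - x = (u - q) + (q - x) := by abel
        rw [e, inner_add_right] at h1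
        linarith)
      rw [hqx, sub_self, norm_zero] at hq
      exact hε.ne hq
    refine ⟨(d - ⟪v, q - x⟫ - a) / ε, div_pos (by linarith) hε, fun u b hu hu' => ?_⟩
    have h1 := hmin (show u ∈ Metric.sphere x ε by rwa [mem_sphere_iff_norm])
    simp only [mem_ofPred_eq, hd, hu] at h1
    have h2 : d + -⟪v, q - x⟫ ≤ b + -⟪v, u - x⟫ := by exact_mod_cast h1
    rw [div_mul_cancel₀ _ hε.ne']
    linarith
  refine ⟨δ, hδ, fun u b hu hR => ?_⟩
  have hR0 : 0 < ‖u - x‖ := hε.trans_le hR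
  have hs0 : 0 < ε / ‖u - x‖ := div_pos hε hR0
  have hs1 : ε / ‖u - x‖ ≤ 1 := (div_le_one hR0).2 hR
  obtain ⟨d, hd, hd'⟩ := hc.exists_coe_le hb ha hu (sub_nonneg.2 hs1) hs0.le (by ring)
  have e : (1 - ε / ‖u - x‖) • x + (ε / ‖u - x‖) • u - x = (ε / ‖u - x‖) • (u - x) := by module
  have h1 := hsph _ d hd (by
    rw [e, norm_smul, Real.norm_of_nonneg hs0.le, div_mul_cancel₀ _ hR0.ne'])
  rw [e, real_inner_smul_right] at h1
  have e2 : δ * ε = (ε / ‖u - x‖) * (δ * ‖u - x‖) := by field_simp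
  refine le_of_mul_le_mul_left ?_ hs0
  linarith

/-- Fréchet differentiability of the conjugate of an essentially strictly convex function at
every point where it has a subgradient (upper estimate; the lower one is the subgradient
inequality). -/
theorem eventually_conj_le [FiniteDimensional ℝ E] (hs : IsEssStrictlyConvex h)
    (hc : IsConvexFun h) (hp : IsProper h) (hl : LowerSemicontinuous h) {x v : E}
    (hx : x ∈ convexSubdiff (conj h) v) {c : ℝ} (hcv : conj h v = c) {ε : ℝ} (hε : 0 < ε) :
    ∀ᶠ w in 𝓝 v, conj h w ≤ ((c + ⟪x, w - v⟫ + ε * ‖w - v‖ : ℝ) : EReal) := by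
  have hv := mem_convexSubdiff_of_conj hc hp hl hx
  obtain ⟨a, ha⟩ := exists_coe_of_mem_convexSubdiff hv
  have hca : c = ⟪v, x⟫ - a := by
    have := conj_eq_of_mem_convexSubdiff hp.2 hv ha
    rw [hcv] at this
    exact_mod_cast this
  obtain ⟨δ, hδ, hgrow⟩ := exists_growth_of_unique_subgradient hc hp.2 hl hv
    (fun y hy => hs.eq_of_mem_convexSubdiff hc hp.2 hy hv) ha hε
  filter_upwards [Metric.ball_mem_nhds v hδ] with w hw
  rw [Metric.mem_ball, dist_eq_norm] at hw
  refine (conj_le_coe_iff hp.2).2 fun u b hu => ?_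
  have hcs : ⟪w - v, u - x⟫ ≤ ‖w - v‖ * ‖u - x‖ := real_inner_le_norm _ _
  have e : ⟪w, u⟫ = ⟪v, x⟫ + ⟪v, u - x⟫ + ⟪x, w - v⟫ + ⟪w - v, u - x⟫ := by
    simp only [inner_sub_left, inner_sub_right, real_inner_comm w x, real_inner_comm v x]
    ring
  rw [e]
  rcases le_or_gt ε ‖u - x‖ with hR | hR
  · have h1 := hgrow u b hu hR
    have h2 : ‖w - v‖ * ‖u - x‖ ≤ δ * ‖u - x‖ :=
      mul_le_mul_of_nonneg_right hw.le (norm_nonneg _)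
    have h3 : 0 ≤ ε * ‖w - v‖ := by positivity
    linarith
  · have h1 := subgradient_ineq hv ha hu
    have h2 : ‖w - v‖ * ‖u - x‖ ≤ ‖w - v‖ * ε :=
      mul_le_mul_of_nonneg_left hR.le (norm_nonneg _)
    linarith

/-! ### Limits of subgradients -/

/-- The graph of the subdifferential is closed, and the function is continuous along it. -/
theorem mem_convexSubdiff_of_tendsto (hp : IsProper h) (hl : LowerSemicontinuous h)
    {xs vs : ℕ → E} {x v : E} {c : ℕ → ℝ} (hv : ∀ k, vs k ∈ convexSubdiff h (xs k))
    (hc : ∀ k, h (xs k) = c k) (hx : Tendsto xs atTop (𝓝 x)) (hv' : Tendsto vs atTop (𝓝 v)) :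
    ∃ a : ℝ, h x = a ∧ v ∈ convexSubdiff h x ∧ Tendsto c atTop (𝓝 a) := by
  have hsub : ∀ u b, h u = (b : ℝ) → ∀ k, c k ≤ b - ⟪vs k, u - xs k⟫ := fun u b hu k => by
    linarith [subgradient_ineq (hv k) (hc k) hu]
  have hlim : ∀ u, Tendsto (fun k => ⟪vs k, u - xs k⟫) atTop (𝓝 ⟪v, u - x⟫) := fun u =>
    hv'.inner (tendsto_const_nhds.sub hx)
  have hlow : ∀ r : ℝ, (r : EReal) < h x → ∀ᶠ k in atTop, r < c k := fun r hr => by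
    filter_upwards [hx.eventually (hl x r hr)] with k hk
    rw [hc k] at hk
    exact_mod_cast hk
  have hupper : ∀ u b, h u = (b : ℝ) → h x ≤ ((b - ⟪v, u - x⟫ : ℝ) : EReal) := by
    intro u b hu
    refine EReal.le_of_forall_lt_iff_le.1 fun r hr => ?_
    have h1 : b - ⟪v, u - x⟫ < r := by exact_mod_cast hr
    by_contra hcon
    have h2 := (hlow r (not_le.1 hcon)).and
      (((tendsto_const_nhds (x := b)).sub (hlim u)).eventually (gt_mem_nhds h1))
    obtain ⟨k, hk1, hk2⟩ := h2.exists
    linarith [hsub u b hu k]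
  obtain ⟨u₀, hu₀⟩ := hp.1
  obtain ⟨b₀, hb₀⟩ := exists_coe_of_lt_top hp.2 hu₀
  obtain ⟨a, ha⟩ : ∃ a : ℝ, h x = a :=
    exists_coe_of_lt_top hp.2 ((hupper u₀ b₀ hb₀).trans_lt (EReal.coe_lt_top _))
  refine ⟨a, ha, (mem_convexSubdiff_iff hp.2 ha).2 fun u b hu => ?_, ?_⟩
  · have := hupper u b hu
    rw [ha] at this
    have : a ≤ b - ⟪v, u - x⟫ := by exact_mod_cast this
    linarith
  · refine tendsto_order.2 ⟨fun r hr => hlow r (by rw [ha]; exact_mod_cast hr), fun r hr => ?_⟩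
    have h1 := (tendsto_const_nhds (x := a)).sub (hlim x)
    rw [sub_self, inner_zero_right, sub_zero] at h1
    filter_upwards [h1.eventually (gt_mem_nhds hr)] with k hk
    exact (hsub x a ha k).trans_lt hk

/-! ### Coercivity of the conjugate -/

/-- If a convex function is finite around a compact set `C`, then its conjugate grows faster than
each of the linear functions `⟨q, ·⟩`, `q ∈ C`, uniformly in `q`. -/
theorem exists_conj_coercive [FiniteDimensional ℝ E] (hc : IsConvexFun h) (hp : IsProper h)
    {C : Set E} (hC : IsCompact C) (hCd : C ⊆ interior (effDom h)) :
    ∃ δ M : ℝ, 0 < δ ∧ ∀ q ∈ C, ∀ y : E,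
      ((⟪q, y⟫ + δ * ‖y‖ - M : ℝ) : EReal) ≤ conj h y := by
  have hconv : ConvexOn ℝ (effDom h) (fun x => (h x).toReal) := by
    have key : ∀ x ∈ effDom h, ∀ y ∈ effDom h, ∀ s t : ℝ, 0 ≤ s → 0 ≤ t → s + t = 1 →
        s • x + t • y ∈ effDom h ∧
          (h (s • x + t • y)).toReal ≤ s • (h x).toReal + t • (h y).toReal := by
      intro x hx y hy s t hs ht hst
      obtain ⟨a, ha⟩ := exists_coe_of_lt_top hp.2 hx
      obtain ⟨b, hb⟩ := exists_coe_of_lt_top hp.2 hy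
      obtain ⟨d, hd, hd'⟩ := hc.exists_coe_le hp.2 ha hb hs ht hst
      refine ⟨?_, by simpa [hd, ha, hb] using hd'⟩
      rw [effDom, mem_ofPred_eq, hd]
      exact EReal.coe_lt_top d
    exact ⟨fun x hx y hy s t hs ht hst => (key x hx y hy s t hs ht hst).1,
      fun x hx y hy s t hs ht hst => (key x hx y hy s t hs ht hst).2⟩
  obtain ⟨δ, hδ, hsub⟩ := hC.exists_cthickening_subset_open isOpen_interior hCd
  obtain ⟨M, hM⟩ := (hC.cthickening (r := δ)).bddAbove_image
    (hconv.continuousOn_interior.mono hsub)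
  refine ⟨δ, M, hδ, fun q hq y => ?_⟩
  obtain ⟨e, he, hye⟩ : ∃ e : E, ‖e‖ ≤ 1 ∧ ⟪y, e⟫ = ‖y‖ := by
    rcases eq_or_ne y 0 with rfl | hy
    · exact ⟨0, by simp, by simp⟩
    · refine ⟨‖y‖⁻¹ • y, by rw [norm_smul, norm_inv, norm_norm,
        inv_mul_cancel₀ (norm_ne_zero_iff.2 hy)], ?_⟩
      rw [real_inner_smul_right, real_inner_self_eq_norm_sq]
      field_simp
  have hmem : q + δ • e ∈ Metric.cthickening δ C := by
    refine Metric.mem_cthickening_of_dist_le _ q δ C hq ?_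
    rw [dist_eq_norm, add_sub_cancel_left, norm_smul, Real.norm_of_nonneg hδ.le]
    nlinarith
  obtain ⟨b, hb⟩ := exists_coe_of_lt_top hp.2
    (show q + δ • e ∈ effDom h from interior_subset (hsub hmem))
  refine le_trans ?_ (coe_le_conj (v := y) hb)
  have hbM : b ≤ M := by
    have := hM (mem_image_of_mem _ hmem)
    simpa [hb] using this
  rw [inner_add_right, real_inner_smul_right, hye, real_inner_comm y q]
  exact_mod_cast (by linarith : ⟪y, q⟫ + δ * ‖y‖ - M ≤ ⟪y, q⟫ + δ * ‖y‖ - b)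

theorem intrinsicInterior_eq_interior {s : Set E} (hs : (interior s).Nonempty) :
    intrinsicInterior ℝ s = interior s := by
  refine subset_antisymm ?_ interior_subset_intrinsicInterior
  have hspan : affineSpan ℝ s = ⊤ := by
    rw [← top_le_iff, ← isOpen_interior.affineSpan_eq_top hs]
    exact affineSpan_mono ℝ interior_subset
  have hopen : IsOpen (affineSpan ℝ s : Set E) := by rw [hspan]; simp
  rintro _ ⟨y, hy, rfl⟩
  have h1 := hopen.isOpenMap_subtype_val.image_interior_subset _ (mem_image_of_mem _ hy)
  exact interior_mono (image_preimage_subset _ _) h1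

end Convex

/-! ### Rates of convergence from the Łojasiewicz inequality -/

section Rates

/-- The concavity inequality for `t ↦ t ^ (1 - θ)`, multiplied by `e ^ θ`. -/
theorem one_sub_mul_sub_le_rpow {θ e e' : ℝ} (h0 : 0 ≤ θ) (h1 : θ < 1) (he : 0 < e)
    (he' : 0 ≤ e') : (1 - θ) * (e - e') ≤ e ^ θ * (e ^ (1 - θ) - e' ^ (1 - θ)) := by
  have h2 := Real.geom_mean_le_arith_mean2_weighted h0 (sub_nonneg.2 h1.le) he.le he' (by ring)
  have h3 : e ^ θ * e ^ (1 - θ) = e := by rw [← Real.rpow_add he]; simp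
  rw [mul_sub (e ^ θ), h3]
  linarith

theorem two_mul_le_add_of_sq_le_mul {d u v : ℝ} (hu : 0 ≤ u) (hv : 0 ≤ v) (h : d ^ 2 ≤ u * v) :
    2 * d ≤ u + v := by
  refine le_of_sq_le_sq ?_ (by positivity)
  nlinarith [sq_nonneg (u - v)]

variable {E D : ℕ → ℝ} {N : ℕ} {a C θ : ℝ}

/-- Telescoping the desingularized energy bounds the length of the trajectory. -/
theorem sum_Ico_add_le (h0 : 0 ≤ θ) (h1 : θ < 1) (ha : 0 < a) (hC : 0 < C)
    (hD : ∀ k, 0 ≤ D k) (hE : ∀ k, N ≤ k → 0 ≤ E k)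
    (hdec : ∀ k, N ≤ k → a * D k ^ 2 ≤ E k - E (k + 1))
    (hKL : ∀ k, N ≤ k → 0 < E (k + 1) → E (k + 1) ^ θ ≤ C * D k)
    {k m : ℕ} (hk : N ≤ k) (hm : k ≤ m) :
    ∑ j ∈ Finset.Ico (k + 1) (m + 1), D j + D m ≤
      D k + C / ((1 - θ) * a) * (E (k + 1) ^ (1 - θ) - E (m + 1) ^ (1 - θ)) := by
  have h1' : 0 < 1 - θ := sub_pos.2 h1
  have step : ∀ k, N ≤ k → 2 * D (k + 1) ≤
      D k + C / ((1 - θ) * a) * (E (k + 1) ^ (1 - θ) - E (k + 2) ^ (1 - θ)) := by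
    intro k hk
    have hd := hdec (k + 1) (by lia)
    have he := hE (k + 1) (by lia)
    have he' := hE (k + 2) (by lia)
    have had : 0 ≤ a * D (k + 1) ^ 2 := by positivity
    rcases he.eq_or_lt with hz | hpos
    · have hz' : E (k + 2) = 0 := by rw [← hz] at hd; linarith
      have hDz : D (k + 1) ^ 2 = 0 := by
        rw [← hz, show k + 1 + 1 = k + 2 from rfl, hz'] at hd
        nlinarith [sq_nonneg (D (k + 1))]
      rw [← hz, hz', sub_self, mul_zero, pow_eq_zero_iff two_ne_zero |>.1 hDz]
      linarith [hD k]
    · have hΦ : 0 ≤ E (k + 1) ^ (1 - θ) - E (k + 2) ^ (1 - θ) :=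
        sub_nonneg.2 (Real.rpow_le_rpow he' (by
          rw [show k + 1 + 1 = k + 2 from rfl] at hd
          linarith) h1'.le)
      refine two_mul_le_add_of_sq_le_mul (hD k) (by positivity) ?_
      have h2 := one_sub_mul_sub_le_rpow h0 h1 hpos he'
      have h3 := mul_le_mul_of_nonneg_right (hKL k hk hpos) hΦ
      have h4 := mul_le_mul_of_nonneg_left hd h1'.le
      have h5 : (1 - θ) * a * D (k + 1) ^ 2 ≤
          C * D k * (E (k + 1) ^ (1 - θ) - E (k + 2) ^ (1 - θ)) := by
        rw [mul_assoc]; exact h4.trans (h2.trans h3)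
      have h6 : D k * (C / ((1 - θ) * a) * (E (k + 1) ^ (1 - θ) - E (k + 2) ^ (1 - θ))) =
          C * D k * (E (k + 1) ^ (1 - θ) - E (k + 2) ^ (1 - θ)) / ((1 - θ) * a) := by ring
      rw [h6, le_div_iff₀ (by positivity)]
      linarith
  induction m, hm using Nat.le_induction with
  | base => simp
  | succ m hm ih =>
    rw [Finset.sum_Ico_succ_top (by lia)]
    have := step m (by lia)
    rw [show m + 1 + 1 = m + 2 from rfl]
    linarith

/-- Linear decay from `E (k + 1) ≤ B (E k - E (k + 1))`. -/
theorem exists_geometric_bound {B : ℝ} (hB : 0 < B) (hE : ∀ k, N ≤ k → 0 ≤ E k)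
    (h : ∀ k, N ≤ k → E (k + 1) ≤ B * (E k - E (k + 1))) :
    ∃ M q : ℝ, 0 < M ∧ 0 < q ∧ q < 1 ∧ ∀ k, N ≤ k → E k ≤ M * q ^ k := by
  have hq : 0 < B / (1 + B) := by positivity
  refine ⟨(E N + 1) / (B / (1 + B)) ^ N, B / (1 + B), ?_, hq, ?_, fun k hk => ?_⟩
  · have := hE N le_rfl
    positivity
  · rw [div_lt_one (by positivity)]; linarith
  · induction k, hk using Nat.le_induction with
    | base => rw [div_mul_cancel₀ _ (by positivity)]; linarith
    | succ k hk ih =>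
      have h1 : E (k + 1) ≤ E k * (B / (1 + B)) := by
        rw [← mul_div_assoc, le_div_iff₀ (by positivity)]
        linarith [h k hk]
      rw [pow_succ, ← mul_assoc]
      exact h1.trans (mul_le_mul_of_nonneg_right ih hq.le)

/-- One step multiplies `k ^ (-s)` by `1 - O(1 / k)`, with an explicit constant. -/
theorem rpow_neg_le_succ {s : ℝ} (hs : 0 < s) {k : ℕ} (hk : 1 ≤ k) :
    (k : ℝ) ^ (-s) ≤
      ((k + 1 : ℕ) : ℝ) ^ (-s) * (1 + 2 * s * Real.exp s / ((k + 1 : ℕ) : ℝ)) := by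
  have hk0 : (0 : ℝ) < k := by exact_mod_cast hk
  have hk1 : (1 : ℝ) ≤ k := by exact_mod_cast hk
  have h1 : (((k + 1 : ℕ) : ℝ) / k) ^ s ≤ Real.exp (s / k) := by
    have h2 : ((k + 1 : ℕ) : ℝ) / k ≤ Real.exp (1 / k) := by
      have := Real.add_one_le_exp (1 / (k : ℝ))
      refine le_trans (le_of_eq ?_) this
      push_cast; field_simp; ring
    refine (Real.rpow_le_rpow (by positivity) h2 hs.le).trans (le_of_eq ?_)
    rw [← Real.exp_mul]; ring_nf
  have h2 : Real.exp (s / k) ≤ 1 + s / k * Real.exp s := by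
    have h3 : Real.exp (s / k) ≤ Real.exp s :=
      Real.exp_le_exp.2 (div_le_self hs.le hk1)
    have h4 := Real.add_one_le_exp (-(s / k))
    have h5 : Real.exp (s / k) * Real.exp (-(s / k)) = 1 := by rw [← Real.exp_add]; simp
    have h6 := mul_le_mul_of_nonneg_left h4 (Real.exp_pos (s / k)).le
    have h7 := mul_le_mul_of_nonneg_left h3 (show 0 ≤ s / k by positivity)
    nlinarith
  have h3 : s / k * Real.exp s ≤ 2 * s * Real.exp s / ((k + 1 : ℕ) : ℝ) := by
    rw [div_mul_eq_mul_div, div_le_div_iff₀ hk0 (by positivity)]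
    have : 0 < s * Real.exp s := by positivity
    push_cast
    nlinarith
  have h4 : (k : ℝ) ^ (-s) =
      ((k + 1 : ℕ) : ℝ) ^ (-s) * (((k + 1 : ℕ) : ℝ) / k) ^ s := by
    rw [Real.div_rpow (by positivity) hk0.le, Real.rpow_neg (by positivity),
      Real.rpow_neg (by positivity)]
    have : 0 < ((k + 1 : ℕ) : ℝ) ^ s := by positivity
    field_simp
  rw [h4]
  exact mul_le_mul_of_nonneg_left (by linarith) (by positivity)

/-- Sublinear decay from `E (k + 1) ^ p ≤ B (E k - E (k + 1))` with `p > 1`: the sequence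
`M k ^ (-1 / (p - 1))` is a supersolution of the recursion once `M` is large. -/
theorem exists_power_bound {B p : ℝ} (hB : 0 < B) (hp : 1 < p) (hN : 1 ≤ N)
    (h : ∀ k, N ≤ k → E (k + 1) ^ p ≤ B * (E k - E (k + 1))) :
    ∃ M : ℝ, 0 < M ∧ ∀ k, N ≤ k → E k ≤ M * (k : ℝ) ^ (-(1 / (p - 1))) := by
  set s : ℝ := 1 / (p - 1) with hs
  have hp1 : 0 < p - 1 := sub_pos.2 hp
  have hs0 : 0 < s := by positivity
  have hN0 : (0 : ℝ) < N := by exact_mod_cast hN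
  have hNs : 0 < (N : ℝ) ^ (-s) := by positivity
  set Q : ℝ := B * (2 * s * Real.exp s) with hQ
  have hQ0 : 0 < Q := by positivity
  set M : ℝ := max (Q ^ s) (E N / (N : ℝ) ^ (-s)) with hM
  have hM0 : 0 < M := lt_of_lt_of_le (by positivity) (le_max_left _ _)
  have hMp : Q ≤ M ^ (p - 1) := by
    have : (Q ^ s) ^ (p - 1) ≤ M ^ (p - 1) :=
      Real.rpow_le_rpow (by positivity) (le_max_left _ _) hp1.le
    rwa [← Real.rpow_mul hQ0.le, hs, one_div, inv_mul_cancel₀ hp1.ne', Real.rpow_one] at this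
  refine ⟨M, hM0, fun k hk => ?_⟩
  induction k, hk using Nat.le_induction with
  | base => rw [← div_le_iff₀ hNs]; exact le_max_right _ _
  | succ k hk ih =>
    by_contra! hcon
    have hk1 : (0 : ℝ) < ((k + 1 : ℕ) : ℝ) := by positivity
    set K : ℝ := ((k + 1 : ℕ) : ℝ) with hK
    have hKs : 0 < K ^ (-s) := by positivity
    -- The exponent satisfies `s p = s + 1`.
    have h1 : (M * K ^ (-s)) ^ p = M ^ (p - 1) * (M * K ^ (-s)) / K := by
      have e1 : M ^ p = M ^ (p - 1) * M := by
        rw [← Real.rpow_add_one hM0.ne']; simp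
      have e2 : (K ^ (-s)) ^ p = K ^ (-s) / K := by
        rw [← Real.rpow_mul hk1.le, ← Real.rpow_sub_one hk1.ne']
        congr 1
        rw [hs]; field_simp; ring
      rw [Real.mul_rpow hM0.le hKs.le, e1, e2]; ring
    have h2 : (M * K ^ (-s)) ^ p ≤ E (k + 1) ^ p :=
      Real.rpow_le_rpow (by positivity) hcon.le (by linarith)
    have h3 := h k hk
    have h4 := rpow_neg_le_succ hs0 (hN.trans hk)
    have h5 : Q * (M * K ^ (-s)) / K ≤ M ^ (p - 1) * (M * K ^ (-s)) / K := by gcongr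
    have h6 : B * E k ≤ B * (M * (K ^ (-s) * (1 + 2 * s * Real.exp s / K))) :=
      mul_le_mul_of_nonneg_left (ih.trans (mul_le_mul_of_nonneg_left h4 hM0.le)) hB.le
    have h7 : B * (M * (K ^ (-s) * (1 + 2 * s * Real.exp s / K))) =
        B * (M * K ^ (-s)) + Q * (M * K ^ (-s)) / K := by rw [hQ]; ring
    have h8 := mul_lt_mul_of_pos_left hcon hB
    linarith

/-- The length of a trajectory with sufficient decrease and the Łojasiewicz inequality with
exponent `θ`: the remaining length `R k` vanishes, is bounded geometrically, or is bounded by a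
power of `k`, according to `θ`. -/
theorem exists_tail_bound (h0 : 0 ≤ θ) (h1 : θ < 1) (ha : 0 < a) (hC : 0 < C)
    (hD : ∀ k, 0 ≤ D k) (hE : ∀ k, N ≤ k → 0 ≤ E k) (hlim : Tendsto E atTop (𝓝 0))
    (hdec : ∀ k, N ≤ k → a * D k ^ 2 ≤ E k - E (k + 1))
    (hKL : ∀ k, N ≤ k → 0 < E (k + 1) → E (k + 1) ^ θ ≤ C * D k) :
    ∃ R : ℕ → ℝ, Tendsto R atTop (𝓝 0) ∧
      (∀ k, N < k → ∀ m, k ≤ m → ∑ j ∈ Finset.Ico k m, D j ≤ R k) ∧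
      (θ = 0 → ∃ k₁, ∀ k, k₁ ≤ k → R k = 0) ∧
      (0 < θ → θ ≤ 1 / 2 → ∃ (k₁ : ℕ) (q κ : ℝ), 0 < q ∧ q < 1 ∧ 0 < κ ∧
        ∀ k, k₁ ≤ k → R k ≤ κ * q ^ k) ∧
      (1 / 2 < θ → ∃ (k₁ : ℕ) (κ : ℝ), 0 < κ ∧
        ∀ k : ℕ, k₁ ≤ k → R k ≤ κ * (k : ℝ) ^ (-((1 - θ) / (2 * θ - 1)))) := by
  have h1' : 0 < 1 - θ := sub_pos.2 h1
  set C' := C / ((1 - θ) * a) with hC'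
  have hC'0 : 0 < C' := by positivity
  have hDE : ∀ k, N ≤ k → a * D k ^ 2 ≤ E k := fun k hk => by
    linarith [hdec k hk, hE (k + 1) (by lia)]
  have hDlim : Tendsto D atTop (𝓝 0) := by
    have h2 : Tendsto (fun k => Real.sqrt (E k / a)) atTop (𝓝 0) := by
      have := (hlim.div_const a).sqrt
      simpa using this
    refine squeeze_zero' (Eventually.of_forall hD) ?_ h2
    filter_upwards [eventually_ge_atTop N] with k hk
    refine Real.le_sqrt_of_sq_le ?_
    rw [le_div_iff₀ ha, mul_comm]
    exact hDE k hk
  have hE1 : ∀ᶠ k in atTop, E k < 1 := hlim.eventually (gt_mem_nhds one_pos)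
  have hanti : ∀ k, N ≤ k → E (k + 1) ≤ E k := fun k hk => by
    have : 0 ≤ a * D k ^ 2 := by positivity
    linarith [hdec k hk]
  refine ⟨fun k => D (k - 1) + C' * E k ^ (1 - θ), ?_, ?_, ?_, ?_, ?_⟩
  · have h2 : Tendsto (fun k => E k ^ (1 - θ)) atTop (𝓝 0) := by
      have := hlim.rpow_const (p := 1 - θ) (Or.inr h1'.le)
      rwa [Real.zero_rpow h1'.ne'] at this
    have h3 := (hDlim.comp (tendsto_sub_atTop_nat 1)).add (h2.const_mul C')
    simpa using h3
  · intro k hk m hm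
    obtain ⟨k, rfl⟩ : ∃ j, k = j + 1 := ⟨k - 1, by lia⟩
    obtain ⟨m, rfl⟩ : ∃ j, m = j + 1 := ⟨m - 1, by lia⟩
    have h2 := sum_Ico_add_le h0 h1 ha hC hD hE hdec hKL (k := k) (m := m) (by lia) (by lia)
    have h3 : 0 ≤ C' * E (m + 1) ^ (1 - θ) :=
      mul_nonneg hC'0.le (Real.rpow_nonneg (hE _ (by lia)) _)
    rw [mul_sub] at h2
    simp only [Nat.add_sub_cancel]
    linarith [hD m]
  · rintro rfl
    have h2 : ∀ᶠ k in atTop, C * D k < 1 :=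
      (hDlim.const_mul C).eventually (gt_mem_nhds (by simp))
    obtain ⟨n, hn⟩ := eventually_atTop.1 (h2.and (eventually_ge_atTop N))
    have hz : ∀ k, n ≤ k → E (k + 1) = 0 := by
      intro k hk
      obtain ⟨h3, h4⟩ := hn k hk
      rcases (hE (k + 1) (by lia)).eq_or_lt with h5 | h5
      · exact h5.symm
      · have := hKL k h4 h5
        rw [Real.rpow_zero] at this
        linarith
    refine ⟨n + 2, fun k hk => ?_⟩
    obtain ⟨j, rfl⟩ : ∃ j, k = j + 2 := ⟨k - 2, by lia⟩
    have h3 := hDE (j + 1) (by have := (hn j (by lia)).2; lia)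
    rw [hz j (by lia)] at h3
    have h4 : D (j + 1) ^ 2 = 0 := by nlinarith [sq_nonneg (D (j + 1))]
    simp [hz (j + 1) (by lia), pow_eq_zero_iff two_ne_zero |>.1 h4]
  all_goals
    intro hθ
    have hθ0 : 0 < θ := by linarith
    obtain ⟨n, hn⟩ := eventually_atTop.1 ((hE1.and (eventually_ge_atTop N)).and
      (eventually_ge_atTop 1))
    have hB : 0 < C ^ 2 / a := by positivity
    -- The Łojasiewicz inequality and sufficient decrease give a recursion for the energy alone.
    have hrec : ∀ k, n ≤ k → E (k + 1) ^ (2 * θ) ≤ C ^ 2 / a * (E k - E (k + 1)) := by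
      intro k hk
      have hNk := (hn k hk).1.2
      have hd := hdec k hNk
      rcases (hE (k + 1) (by lia)).eq_or_lt with h5 | h5
      · rw [← h5, Real.zero_rpow (by positivity), sub_zero]
        exact mul_nonneg hB.le (hE k hNk)
      · have h6 := pow_le_pow_left₀ (by positivity) (hKL k hNk h5) 2
        rw [mul_comm 2 θ, Real.rpow_mul h5.le, Real.rpow_two]
        refine h6.trans ?_
        rw [div_mul_eq_mul_div, le_div_iff₀ ha, mul_pow]
        have := mul_le_mul_of_nonneg_left hd (sq_nonneg C)
        linarith
    -- Both terms of `R` are dominated by a power of the energy.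
    have hR : ∀ e : ℝ, 0 < e → e ≤ 1 / 2 → e ≤ 1 - θ → ∀ k, n ≤ k →
        D k + C' * E (k + 1) ^ (1 - θ) ≤ (Real.sqrt a⁻¹ + C') * E k ^ e := by
      intro e he he1 he2 k hk
      have hNk := (hn k hk).1.2
      have hEk := hE k hNk
      have hEk1 := (hn k hk).1.1.le
      have h2 : D k ≤ Real.sqrt a⁻¹ * E k ^ e := by
        have h3 : D k ≤ Real.sqrt (a⁻¹ * E k) := by
          refine Real.le_sqrt_of_sq_le ?_
          rw [inv_mul_eq_div, le_div_iff₀ ha, mul_comm]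
          exact hDE k hNk
        rw [Real.sqrt_mul (by positivity), Real.sqrt_eq_rpow (E k)] at h3
        exact h3.trans (mul_le_mul_of_nonneg_left
          (Real.rpow_le_rpow_of_exponent_ge' hEk hEk1 he.le he1) (Real.sqrt_nonneg _))
      have h4 : E (k + 1) ^ (1 - θ) ≤ E k ^ e :=
        (Real.rpow_le_rpow (hE _ (by lia)) (hanti k hNk) h1'.le).trans
          (Real.rpow_le_rpow_of_exponent_ge' hEk hEk1 he.le he2)
      have := mul_le_mul_of_nonneg_left h4 hC'0.le
      linarith
  · intro hθ2
    obtain ⟨M, q, hM, hq, hq1, hbd⟩ := exists_geometric_bound (N := n) hB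
      (fun k hk => hE k (hn k hk).1.2) (fun k hk => le_trans (by
        have hN := (hn k hk).1.2
        have := Real.rpow_le_rpow_of_exponent_ge' (hE (k + 1) (by lia))
          (hn (k + 1) (by lia)).1.1.le (by positivity) (show 2 * θ ≤ 1 by linarith)
        rwa [Real.rpow_one] at this) (hrec k hk))
    have hsq : 0 < Real.sqrt q := Real.sqrt_pos.2 hq
    refine ⟨n + 1, Real.sqrt q, (Real.sqrt a⁻¹ + C') * Real.sqrt M / Real.sqrt q, hsq, ?_,
      by positivity, fun k hk => ?_⟩
    · rw [Real.sqrt_lt' one_pos]; simpa using hq1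
    obtain ⟨k, rfl⟩ : ∃ j, k = j + 1 := ⟨k - 1, by lia⟩
    have h2 := hR (1 / 2) (by norm_num) le_rfl (by linarith) k (by lia)
    rw [← Real.sqrt_eq_rpow] at h2
    refine h2.trans ?_
    have h3 : Real.sqrt (E k) ≤ Real.sqrt M * Real.sqrt q ^ k := by
      refine (Real.sqrt_le_sqrt (hbd k (by lia))).trans (le_of_eq ?_)
      have h5 : q ^ k = (Real.sqrt q ^ k) ^ 2 := by
        rw [← pow_mul, mul_comm, pow_mul, Real.sq_sqrt hq.le]
      rw [Real.sqrt_mul hM.le, h5, Real.sqrt_sq (by positivity)]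
    have h4 : (Real.sqrt a⁻¹ + C') * Real.sqrt M / Real.sqrt q * Real.sqrt q ^ (k + 1) =
        (Real.sqrt a⁻¹ + C') * (Real.sqrt M * Real.sqrt q ^ k) := by
      rw [pow_succ]; field_simp
    rw [h4]
    exact mul_le_mul_of_nonneg_left h3 (by positivity)
  · obtain ⟨M, hM, hbd⟩ := exists_power_bound (N := n) hB (show 1 < 2 * θ by linarith)
      (hn n le_rfl).2 hrec
    set τ := (1 - θ) / (2 * θ - 1) with hτ
    have h2θ : 0 < 2 * θ - 1 := by linarith
    have hτ0 : 0 < τ := by positivity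
    refine ⟨n + 1, (Real.sqrt a⁻¹ + C') * (M ^ (1 - θ) * 2 ^ τ), by positivity, fun k hk => ?_⟩
    obtain ⟨k, rfl⟩ : ∃ j, k = j + 1 := ⟨k - 1, by lia⟩
    have hk1 := (hn k (by lia)).2
    have hk0 : (0 : ℝ) < k := by exact_mod_cast hk1
    have h2 := hR (1 - θ) h1' (by linarith) le_rfl k (by lia)
    refine h2.trans ?_
    rw [mul_assoc]
    refine mul_le_mul_of_nonneg_left ?_ (by positivity)
    have h3 := Real.rpow_le_rpow (hE k (hn k (by lia)).1.2) (hbd k (by lia)) h1'.le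
    refine h3.trans ?_
    rw [Real.mul_rpow hM.le (by positivity), ← Real.rpow_mul hk0.le, mul_assoc]
    refine mul_le_mul_of_nonneg_left ?_ (by positivity)
    have h4 : -(1 / (2 * θ - 1)) * (1 - θ) = -τ := by rw [hτ]; ring
    rw [h4]
    -- The index shift costs the factor `2 ^ τ`, as `k + 1 ≤ 2 k`.
    have h5 : ((k + 1 : ℕ) : ℝ) ^ τ ≤ 2 ^ τ * (k : ℝ) ^ τ := by
      rw [← Real.mul_rpow (by norm_num) hk0.le]
      refine Real.rpow_le_rpow (by positivity) ?_ hτ0.le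
      have : (1 : ℝ) ≤ k := by exact_mod_cast hk1
      push_cast; linarith
    rw [Real.rpow_neg hk0.le, Real.rpow_neg (by positivity), ← div_eq_mul_inv,
      le_div_iff₀ (by positivity), inv_mul_le_iff₀ (by positivity)]
    linarith

/-- A sequence whose remaining length tends to zero converges, at the rate of that length. -/
theorem exists_limit_of_tail_bound {X : Type*} [MetricSpace X] [CompleteSpace X] {u : ℕ → X}
    {D R : ℕ → ℝ} {N : ℕ} (hu : ∀ k, dist (u k) (u (k + 1)) ≤ D k)
    (hR : Tendsto R atTop (𝓝 0))
    (hsum : ∀ k, N < k → ∀ m, k ≤ m → ∑ j ∈ Finset.Ico k m, D j ≤ R k) :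
    ∃ l, Tendsto u atTop (𝓝 l) ∧ ∀ k, N < k → dist (u k) l ≤ R k := by
  have hdist : ∀ k, N < k → ∀ m, k ≤ m → dist (u k) (u m) ≤ R k := fun k hk m hm =>
    (dist_le_Ico_sum_of_dist_le (f := u) hm fun {j} _ _ => hu j).trans (hsum k hk m hm)
  have hcau : CauchySeq u := by
    refine Metric.cauchySeq_iff'.2 fun ε hε => ?_
    obtain ⟨k, hk, hk'⟩ := ((hR.eventually (gt_mem_nhds hε)).and (eventually_gt_atTop N)).exists
    exact ⟨k, fun m hm => by rw [dist_comm]; exact (hdist k hk' m hm).trans_lt hk⟩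
  obtain ⟨l, hl⟩ := cauchySeq_tendsto_of_complete hcau
  refine ⟨l, hl, fun k hk => le_of_tendsto (tendsto_const_nhds.dist hl) ?_⟩
  filter_upwards [eventually_ge_atTop k] with m hm using hdist k hk m hm

end Rates

/-! ### Quadratic upper bound and bounded subgradients -/

section Aux

variable {E : Type*} [NormedAddCommGroup E] [InnerProductSpace ℝ E]

/-- The descent lemma for functions with Lipschitz gradient. -/
theorem le_add_inner_gradient_add_sq [CompleteSpace E] {φ : E → ℝ} {ℓ : ℝ≥0}
    (hφ : Differentiable ℝ φ) (hlip : LipschitzWith ℓ (gradient φ)) (x d : E) :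
    φ (x + d) ≤ φ x + ⟪gradient φ x, d⟫ + ℓ / 2 * ‖d‖ ^ 2 := by
  have hline : ∀ t : ℝ, HasDerivAt (fun t : ℝ => x + t • d) d t := fun t => by
    simpa using ((hasDerivAt_id t).smul_const d).const_add x
  have hder : ∀ t : ℝ, HasDerivAt
      (fun t : ℝ => φ (x + t • d) - t * ⟪gradient φ x, d⟫ - ℓ / 2 * ‖d‖ ^ 2 * t ^ 2)
      (⟪gradient φ (x + t • d), d⟫ - ⟪gradient φ x, d⟫ - ℓ / 2 * ‖d‖ ^ 2 * (2 * t)) t := by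
    intro t
    have h1 := (hφ (x + t • d)).hasGradientAt.hasFDerivAt.comp_hasDerivAt t (hline t)
    have h2 := (hasDerivAt_id t).mul_const ⟪gradient φ x, d⟫
    have h3 := ((hasDerivAt_pow 2 t).const_mul ((ℓ : ℝ) / 2 * ‖d‖ ^ 2))
    exact ((h1.sub h2).sub h3).congr_deriv (by simp)
  have hanti : AntitoneOn
      (fun t : ℝ => φ (x + t • d) - t * ⟪gradient φ x, d⟫ - ℓ / 2 * ‖d‖ ^ 2 * t ^ 2)
      (Icc 0 1) := by
    refine antitoneOn_of_deriv_nonpos (convex_Icc 0 1)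
      (fun t _ => (hder t).continuousAt.continuousWithinAt)
      (fun t _ => (hder t).differentiableAt.differentiableWithinAt) fun t ht => ?_
    rw [interior_Icc] at ht
    rw [(hder t).deriv, ← inner_sub_left]
    have h1 := hlip.dist_le_mul (x + t • d) x
    rw [dist_eq_norm, dist_eq_norm, add_sub_cancel_left, norm_smul,
      Real.norm_of_nonneg ht.1.le] at h1
    have h2 := real_inner_le_norm (gradient φ (x + t • d) - gradient φ x) d
    have h3 := mul_le_mul_of_nonneg_right h1 (norm_nonneg d)
    nlinarith
  have := hanti (left_mem_Icc.2 zero_le_one) (right_mem_Icc.2 zero_le_one) zero_le_one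
  simp only [one_smul, zero_smul, add_zero, one_mul, zero_mul, sub_zero, one_pow] at this
  linarith

/-- If a convex function is `L`-Lipschitz near `p`, a subgradient `z` at the point `p - t z` has
norm at most `L`, no matter how far this point is from `p`. -/
theorem norm_le_of_mem_convexSubdiff {h : E → EReal} (hc : IsConvexFun h) (hb : ∀ x, ⊥ < h x)
    {T : Set E} {L : ℝ≥0} {p z : E} {t : ℝ} (hT : T ∈ 𝓝 p) (hdom : T ⊆ effDom h)
    (hlip : LipschitzOnWith L (fun v => (h v).toReal) T) (ht : 0 < t)
    (hz : z ∈ convexSubdiff h (p - t • z)) : ‖z‖ ≤ L := by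
  obtain ⟨a, ha⟩ := exists_coe_of_lt_top hb (hdom (mem_of_mem_nhds hT))
  obtain ⟨b, hb'⟩ := exists_coe_of_mem_convexSubdiff hz
  have h1 := subgradient_ineq hz hb' ha
  rw [sub_sub_cancel, real_inner_smul_right, real_inner_self_eq_norm_sq] at h1
  have hcont : Tendsto (fun s : ℝ => p - (s * t) • z) (𝓝[>] 0) (𝓝 p) := by
    have : Tendsto (fun s : ℝ => p - (s * t) • z) (𝓝 0) (𝓝 (p - (0 * t) • z)) :=
      (by fun_prop : Continuous fun s : ℝ => p - (s * t) • z).tendsto 0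
    rw [zero_mul, zero_smul, sub_zero] at this
    exact this.mono_left nhdsWithin_le_nhds
  obtain ⟨s, hsT, hs⟩ := ((hcont.eventually hT).and (Ioc_mem_nhdsGT (zero_lt_one' ℝ))).exists
  obtain ⟨d, hd, hd'⟩ := hc.exists_coe_le hb ha hb' (sub_nonneg.2 hs.2) hs.1.le (by ring)
  have e : (1 - s) • p + s • (p - t • z) = p - (s * t) • z := by module
  rw [e] at hd
  have h2 := hlip.dist_le_mul p (mem_of_mem_nhds hT) _ hsT
  simp only [ha, hd, EReal.toReal_coe] at h2
  rw [Real.dist_eq, dist_eq_norm, sub_sub_cancel, norm_smul,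
    Real.norm_of_nonneg (mul_nonneg hs.1.le ht.le)] at h2
  have h3 := (le_abs_self _).trans h2
  have hst : 0 < s * t := mul_pos hs.1 ht
  have h4 : s * t * (‖z‖ * ‖z‖) ≤ s * t * (L * ‖z‖) := by
    have := mul_le_mul_of_nonneg_left h1 hs.1.le
    nlinarith
  rcases (norm_nonneg z).eq_or_lt with h0 | h0
  · rw [← h0]; exact L.2
  · exact le_of_mul_le_mul_right (le_of_mul_le_mul_left h4 hst) h0

theorem IsProj.inner_le_zero {C : Set E} (hC : Convex ℝ C) {w u : E} (h : IsProj C w u) {s : E}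
    (hs : s ∈ C) : ⟪w - u, s - u⟫ ≤ 0 := by
  refine (norm_eq_iInf_iff_real_inner_le_zero hC h.1).1 ?_ s hs
  have : Nonempty C := ⟨⟨u, h.1⟩⟩
  refine le_antisymm (le_ciInf fun c => ?_) (ciInf_le ⟨0, ?_⟩ (⟨u, h.1⟩ : C))
  · rw [norm_sub_rev, norm_sub_rev w]
    exact h.2 c c.2
  · rintro _ ⟨c, rfl⟩
    exact norm_nonneg _

end Aux

/-! ### The merit function -/

namespace DCProgram

variable {n p s : ℕ} (P : DCProgram n p s)

/-- The coefficient of `‖z - u‖²` in the merit function. -/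
noncomputable def couplingCoeff (α αfin : ℝ) : ℝ := α / 2 * (1 + 4 * α / (αfin - α))

/-- The smooth part of the merit function. -/
noncomputable def smoothMerit (α αfin : ℝ) (x : EuclideanSpace ℝ (Fin n))
    (y : EuclideanSpace ℝ (Fin p)) (z u : EuclideanSpace ℝ (Fin s)) : ℝ :=
  ⟪z, P.A x⟫ + P.phi x - ⟪P.K x, y⟫ + couplingCoeff α αfin * ‖z - u‖ ^ 2
    - 1 / 2 * (αfin - α) * ‖z‖ ^ 2

/-- The real number that is the value of the merit function where the latter is finite. -/
noncomputable def realMerit (α αfin : ℝ) (x : EuclideanSpace ℝ (Fin n))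
    (y : EuclideanSpace ℝ (Fin p)) (z u : EuclideanSpace ℝ (Fin s)) : ℝ :=
  P.smoothMerit α αfin x y z u - (conj P.g z).toReal + (conj P.f y).toReal

/-- The point of `Space4` with the given components. -/
def point (x : EuclideanSpace ℝ (Fin n)) (y : EuclideanSpace ℝ (Fin p))
    (z u : EuclideanSpace ℝ (Fin s)) : Space4 n p s :=
  WithLp.toLp 2 (x, WithLp.toLp 2 (y, WithLp.toLp 2 (z, u)))

theorem inner_point (x : EuclideanSpace ℝ (Fin n)) (y : EuclideanSpace ℝ (Fin p))
    (z u : EuclideanSpace ℝ (Fin s)) (w : Space4 n p s) :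
    ⟪point x y z u, w⟫ = ⟪x, w.fst⟫ + ⟪y, w.snd.fst⟫ + ⟪z, w.snd.snd.fst⟫
      + ⟪u, w.snd.snd.snd⟫ := by
  rw [point, WithLp.prod_inner_apply, WithLp.prod_inner_apply, WithLp.prod_inner_apply]
  simp only [add_assoc]
  rfl

theorem norm_toLp_le {F G : Type*} [NormedAddCommGroup F] [NormedAddCommGroup G] (a : F) (b : G) :
    ‖WithLp.toLp 2 (a, b)‖ ≤ ‖a‖ + ‖b‖ := by
  refine le_of_sq_le_sq ?_ (by positivity)
  rw [WithLp.prod_norm_sq_eq_of_L2]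
  have h1 : (WithLp.toLp 2 (a, b)).fst = a := rfl
  have h2 : (WithLp.toLp 2 (a, b)).snd = b := rfl
  rw [h1, h2]
  nlinarith [mul_nonneg (norm_nonneg a) (norm_nonneg b)]

theorem norm_point_le (x : EuclideanSpace ℝ (Fin n)) (y : EuclideanSpace ℝ (Fin p))
    (z u : EuclideanSpace ℝ (Fin s)) : ‖point x y z u‖ ≤ ‖x‖ + ‖y‖ + ‖z‖ + ‖u‖ := by
  have h1 := norm_toLp_le x (WithLp.toLp 2 (y, WithLp.toLp 2 (z, u)))
  have h2 := norm_toLp_le y (WithLp.toLp 2 (z, u))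
  have h3 := norm_toLp_le z u
  rw [point]
  linarith

theorem continuous_point : Continuous fun w : EuclideanSpace ℝ (Fin n) ×
    EuclideanSpace ℝ (Fin p) × EuclideanSpace ℝ (Fin s) × EuclideanSpace ℝ (Fin s) =>
      point w.1 w.2.1 w.2.2.1 w.2.2.2 := by
  unfold point
  fun_prop

variable {P}

theorem merit_eq_coe {α αfin : ℝ} {w : Space4 n p s} (hx : w.fst ∈ P.S) {b c : ℝ}
    (hb : conj P.f w.snd.fst = b) (hc : conj P.g w.snd.snd.fst = c) :
    P.merit α αfin w =
      ((P.smoothMerit α αfin w.fst w.snd.fst w.snd.snd.fst w.snd.snd.snd - c + b : ℝ) : EReal) := by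
  have hi : indicatorFun P.S w.fst = ((0 : ℝ) : EReal) := by simp [indicatorFun, hx]
  rw [merit, Psi, hi, hb, hc]
  norm_cast
  rw [smoothMerit, couplingCoeff]
  ring

theorem merit_point_eq_coe {α αfin : ℝ} {x : EuclideanSpace ℝ (Fin n)}
    {y : EuclideanSpace ℝ (Fin p)} {z : EuclideanSpace ℝ (Fin s)}
    (u : EuclideanSpace ℝ (Fin s)) (hx : x ∈ P.S) {b c : ℝ}
    (hb : conj P.f y = b) (hc : conj P.g z = c) :
    P.merit α αfin (point x y z u) = ((P.realMerit α αfin x y z u : ℝ) : EReal) := by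
  rw [merit_eq_coe (w := point x y z u) hx hb hc, realMerit, hb, hc]
  rfl

/-- The merit function is `+∞` where it is not finite and `g^*` is finite. -/
theorem merit_eq_top_or {α αfin : ℝ} {w : Space4 n p s} (hf : ∀ y, ⊥ < conj P.f y) {c : ℝ}
    (hc : conj P.g w.snd.snd.fst = c) :
    P.merit α αfin w = ⊤ ∨ (w.fst ∈ P.S ∧ ∃ b : ℝ, conj P.f w.snd.fst = b) := by
  by_cases hx : w.fst ∈ P.S
  · rcases eq_top_or_exists_coe (hf w.snd.fst) with hb | ⟨b, hb⟩
    · left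
      have hi : indicatorFun P.S w.fst = ((0 : ℝ) : EReal) := by simp [indicatorFun, hx]
      rw [merit, Psi, hi, hb, hc]
      simp only [← EReal.coe_sub, ← EReal.coe_add, EReal.coe_add_top, EReal.top_add_coe,
        EReal.top_sub_coe]
    · exact Or.inr ⟨hx, b, hb⟩
  · left
    have hi : indicatorFun P.S w.fst = ⊤ := by simp [indicatorFun, hx]
    rw [merit, Psi, hi, hc]
    simp only [← EReal.coe_sub, ← EReal.coe_add, EReal.coe_add_top, EReal.top_add_coe,
      EReal.top_sub_coe, EReal.top_add_of_ne_bot (hf w.snd.fst).ne']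

/-- First-order expansion of the smooth part of the merit function. -/
theorem eventually_smoothMerit_ge (hφ : Differentiable ℝ P.phi) (α αfin : ℝ)
    (w : Space4 n p s) {ε : ℝ} (hε : 0 < ε) :
    ∀ᶠ w' in 𝓝 w,
      P.smoothMerit α αfin w.fst w.snd.fst w.snd.snd.fst w.snd.snd.snd
        + ⟪point (gradient P.phi w.fst + ContinuousLinearMap.adjoint P.A w.snd.snd.fst
              - ContinuousLinearMap.adjoint P.K w.snd.fst)
            (-P.K w.fst)
            (P.A w.fst + (2 * couplingCoeff α αfin) • (w.snd.snd.fst - w.snd.snd.snd)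
              - (αfin - α) • w.snd.snd.fst)
            (-((2 * couplingCoeff α αfin) • (w.snd.snd.fst - w.snd.snd.snd))), w' - w⟫
        - ε * ‖w' - w‖ ≤
      P.smoothMerit α αfin w'.fst w'.snd.fst w'.snd.snd.fst w'.snd.snd.snd := by
  let p1 : Space4 n p s →L[ℝ] _ := WithLp.fstL 2 ℝ _ _
  let q1 : Space4 n p s →L[ℝ] _ := WithLp.sndL 2 ℝ _ _
  let p2 : Space4 n p s →L[ℝ] _ := (WithLp.fstL 2 ℝ _ _).comp q1
  let q2 : Space4 n p s →L[ℝ] _ := (WithLp.sndL 2 ℝ _ _).comp q1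
  let p3 : Space4 n p s →L[ℝ] _ := (WithLp.fstL 2 ℝ _ _).comp q2
  let p4 : Space4 n p s →L[ℝ] _ := (WithLp.sndL 2 ℝ _ _).comp q2
  have h1 := p3.hasFDerivAt (x := w)
  have h2 := (P.A.comp p1).hasFDerivAt (x := w)
  have h3 := (P.K.comp p1).hasFDerivAt (x := w)
  have h4 := p2.hasFDerivAt (x := w)
  have h5 := (p3 - p4).hasFDerivAt (x := w)
  have h6 : HasFDerivAt (fun w' => P.phi (p1 w')) _ w :=
    (hφ (p1 w)).hasGradientAt.hasFDerivAt.comp w (p1.hasFDerivAt (x := w))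
  have hQ := ((((h1.inner ℝ h2).add h6).sub (h3.inner ℝ h4)).add
    (h5.norm_sq.const_mul (couplingCoeff α αfin))).sub
      (h1.norm_sq.const_mul (1 / 2 * (αfin - α)))
  filter_upwards [hQ.isLittleO.def hε] with w' hw'
  have h7 := (abs_le.1 hw').1
  have e1 : ∀ v, p1 v = v.fst := fun _ => rfl
  have e2 : ∀ v, p2 v = v.snd.fst := fun _ => rfl
  have e3 : ∀ v, p3 v = v.snd.snd.fst := fun _ => rfl
  have e4 : ∀ v, p4 v = v.snd.snd.snd := fun _ => rfl
  have e5 : ∀ v : Space4 n p s, P.smoothMerit α αfin v.fst v.snd.fst v.snd.snd.fst v.snd.snd.snd =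
    ⟪p3 v, (P.A.comp p1) v⟫ + P.phi (p1 v) - ⟪(P.K.comp p1) v, p2 v⟫
      + couplingCoeff α αfin * ‖(p3 - p4) v‖ ^ 2 - 1 / 2 * (αfin - α) * ‖p3 v‖ ^ 2 := fun _ => rfl
  rw [e5, e5, inner_point, ← e1, ← e2, ← e3, ← e4, ← e1, ← e2, ← e3, ← e4]
  generalize w' - w = d at *
  simp only [inner_sub_left, inner_add_left, inner_neg_left, real_inner_smul_left,
    ContinuousLinearMap.adjoint_inner_left]
  simp only [sub_apply, add_apply, smul_apply, ContinuousLinearMap.comp_apply, fderivInnerCLM_apply,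
    ContinuousLinearMap.prod_apply, smul_eq_mul, innerSL_apply_apply, inner_sub_right,
    InnerProductSpace.toDual_apply_apply, nsmul_eq_mul, inner_sub_left, Nat.cast_ofNat,
    Pi.sub_apply, Pi.add_apply] at h7 ⊢
  simp only [real_inner_comm _ (P.A (p1 w)), real_inner_comm _ (P.K (p1 d))] at h7 ⊢
  linarith

theorem norm_snd_snd_fst_le (d : Space4 n p s) : ‖d.snd.snd.fst‖ ≤ ‖d‖ :=
  (WithLp.norm_fst_le _ _).trans ((WithLp.norm_snd_le _ _).trans (WithLp.norm_snd_le _ _))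

/-- Fréchet subgradients of the merit function. The term `-g^*(z)` is concave, but it contributes
its gradient `-ξ`, because `g^*` is differentiable wherever it has a subgradient. -/
theorem mem_frechetSubdiff_merit (hg_proper : IsProper P.g) (hg_conv : IsConvexFun P.g)
    (hg_lsc : LowerSemicontinuous P.g) (hg_strict : IsEssStrictlyConvex P.g)
    (hf_proper : IsProper P.f) (hφ : Differentiable ℝ P.phi) (α αfin : ℝ) {w : Space4 n p s}
    (hx : w.fst ∈ P.S) {ν : EuclideanSpace ℝ (Fin n)} (hν : ∀ q ∈ P.S, ⟪ν, q - w.fst⟫ ≤ 0)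
    {v : EuclideanSpace ℝ (Fin p)} (hv : v ∈ convexSubdiff (conj P.f) w.snd.fst)
    {ξ : EuclideanSpace ℝ (Fin s)} (hξ : ξ ∈ convexSubdiff (conj P.g) w.snd.snd.fst) :
    point (gradient P.phi w.fst + ContinuousLinearMap.adjoint P.A w.snd.snd.fst
          - ContinuousLinearMap.adjoint P.K w.snd.fst + ν)
        (-P.K w.fst + v)
        (P.A w.fst + (2 * couplingCoeff α αfin) • (w.snd.snd.fst - w.snd.snd.snd)
          - (αfin - α) • w.snd.snd.fst - ξ)
        (-((2 * couplingCoeff α αfin) • (w.snd.snd.fst - w.snd.snd.snd)))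
      ∈ frechetSubdiff (P.merit α αfin) w := by
  obtain ⟨b, hb⟩ := exists_coe_of_mem_convexSubdiff hv
  obtain ⟨c, hc⟩ := exists_coe_of_mem_convexSubdiff hξ
  have hw := merit_eq_coe (α := α) (αfin := αfin) hx hb hc
  refine ⟨by rw [hw]; exact EReal.coe_ne_top _, by rw [hw]; exact EReal.coe_ne_bot _,
    fun ε hε => ?_⟩
  have hcont : Tendsto (fun w' : Space4 n p s => w'.snd.snd.fst) (𝓝 w) (𝓝 w.snd.snd.fst) :=
    ((((WithLp.fstL 2 ℝ _ _).comp (WithLp.sndL 2 ℝ _ _)).comp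
      (WithLp.sndL 2 ℝ _ _) : Space4 n p s →L[ℝ] _).continuous).tendsto w
  filter_upwards [eventually_smoothMerit_ge hφ α αfin w (half_pos hε),
    hcont.eventually (eventually_conj_le hg_strict hg_conv hg_proper hg_lsc hξ hc (half_pos hε))]
    with w' h1 h2
  obtain ⟨c', hc'⟩ := exists_coe_of_lt_top (bot_lt_conj hg_proper)
    (h2.trans_lt (EReal.coe_lt_top _))
  rcases merit_eq_top_or (α := α) (αfin := αfin) (bot_lt_conj hf_proper) hc' with
    htop | ⟨hx', b', hb'⟩
  · rw [htop]; exact le_top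
  rw [hw, merit_eq_coe hx' hb' hc', ← EReal.coe_add, EReal.coe_le_coe_iff]
  rw [hc', EReal.coe_le_coe_iff] at h2
  have h3 := subgradient_ineq hv hb hb'
  have h4 := hν _ hx'
  have h5 : ε / 2 * ‖w'.snd.snd.fst - w.snd.snd.fst‖ ≤ ε / 2 * ‖w' - w‖ :=
    mul_le_mul_of_nonneg_left (norm_snd_snd_fst_le (w' - w)) (half_pos hε).le
  have e1 : (w' - w).fst = w'.fst - w.fst := rfl
  have e2 : (w' - w).snd.fst = w'.snd.fst - w.snd.fst := rfl
  have e3 : (w' - w).snd.snd.fst = w'.snd.snd.fst - w.snd.snd.fst := rfl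
  rw [inner_point, e1, e2, e3] at h1 ⊢
  rw [inner_add_left _ ν, inner_add_left _ v, inner_sub_left _ ξ]
  linarith

/-- Elementary estimate behind the descent property, with `X = ‖A (x⁺ - x)‖`, `d = ‖z⁺ - z‖`,
`e = ‖z - z⁻‖`, `c = αfin - α`, and `i`, `j` the inner products of `z⁺ - z` with `A (x⁺ - x)`
and with `z - z⁻`. -/
theorem coupling_estimate {α γ c X d e i j : ℝ} (hα : 0 < α) (hc : 0 < c) (hcγ : c ≤ γ)
    (hαγ : α < γ / 2) (hd : 0 ≤ d) (he : 0 ≤ e) (hX : 0 ≤ X) (hi : i ≤ X * d) (hj : j ≤ e * d)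
    (hmono : (α + c) * d ^ 2 ≤ i + α * j) :
    i + α * j - c / 2 * d ^ 2 + α / 2 * (1 + 4 * α / c) * (d ^ 2 - e ^ 2) ≤
      3 * γ / (2 * c ^ 2) * X ^ 2 - α * d ^ 2 := by
  have h1 : (α + c) * d ≤ X + α * e := by
    rcases hd.eq_or_lt with rfl | hd
    · simp only [mul_zero]; positivity
    · refine le_of_mul_le_mul_right ?_ hd
      nlinarith
  have h2 : (α + c) * d ^ 2 ≤ X ^ 2 / c + α * e ^ 2 := by
    -- Weighted Cauchy–Schwarz with the weights `c` and `α`.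
    have h3 : ((α + c) * d) ^ 2 ≤ (X + α * e) ^ 2 := pow_le_pow_left₀ (by positivity) h1 2
    have h4 : (X + α * e) ^ 2 ≤ (α + c) * (X ^ 2 / c + α * e ^ 2) := by
      have h5 : (α + c) * (X ^ 2 / c + α * e ^ 2) - (X + α * e) ^ 2 =
          α / c * (X - c * e) ^ 2 := by field_simp; ring
      have h6 : 0 ≤ α / c * (X - c * e) ^ 2 := by positivity
      linarith
    refine le_of_mul_le_mul_left ?_ (add_pos hα hc)
    calc _ = ((α + c) * d) ^ 2 := by ring
      _ ≤ _ := h3.trans h4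
  have h3 : 2 * α / c * (α * d ^ 2 - α * e ^ 2) ≤ 2 * α / c * (X ^ 2 / c - c * d ^ 2) :=
    mul_le_mul_of_nonneg_left (by linarith) (by positivity)
  have h4 : 2 * α / c * (X ^ 2 / c - c * d ^ 2) = 2 * α * (X ^ 2 / c ^ 2) - 2 * α * d ^ 2 := by
    field_simp
  have h5 : α / 2 * (1 + 4 * α / c) * (d ^ 2 - e ^ 2) =
      α / 2 * (d ^ 2 - e ^ 2) + 2 * α / c * (α * d ^ 2 - α * e ^ 2) := by field_simp; ring
  have h6 : X * d ≤ c / 2 * (X ^ 2 / c ^ 2) + c / 2 * d ^ 2 := by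
    have h7 : c / 2 * (X ^ 2 / c ^ 2) + c / 2 * d ^ 2 - X * d = c / 2 * (X / c - d) ^ 2 := by
      field_simp; ring
    have h8 : 0 ≤ c / 2 * (X / c - d) ^ 2 := by positivity
    linarith
  have h7 : 3 * γ / (2 * c ^ 2) * X ^ 2 = 3 * γ / 2 * (X ^ 2 / c ^ 2) := by field_simp
  have h8 : (c / 2 + 2 * α) * (X ^ 2 / c ^ 2) ≤ 3 * γ / 2 * (X ^ 2 / c ^ 2) :=
    mul_le_mul_of_nonneg_right (by linarith) (by positivity)
  have h9 : α * j ≤ α * ((d ^ 2 + e ^ 2) / 2) :=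
    mul_le_mul_of_nonneg_left (by nlinarith [sq_nonneg (d - e)]) hα.le
  rw [h5, h7]
  linarith

/-- One step of the algorithm with `α_k = αfin` decreases the merit function. The primal steps
decrease it by themselves; the increase in the `z`-step is controlled by the monotonicity of
`∂g^*` at two consecutive `z`-iterates. -/
theorem realMerit_step_le (hφ : Differentiable ℝ P.phi) {ℓ : ℝ≥0}
    (hlip : LipschitzWith ℓ (gradient P.phi)) {α γ μ c ρ β : ℝ} (hα : 0 < α) (hc : 0 < c)
    (hcγ : c ≤ γ) (hαγ : α < γ / 2)
    (hρ : ρ = ℓ / 2 + 3 * γ * ‖P.A‖ ^ 2 / (2 * c ^ 2) + μ)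
    {x x' : EuclideanSpace ℝ (Fin n)} {y y' : EuclideanSpace ℝ (Fin p)}
    {z₀ z z' : EuclideanSpace ℝ (Fin s)} {b b' : ℝ}
    (hx : ⟪ρ • (x - x') - gradient P.phi x + ContinuousLinearMap.adjoint P.K y
      - ContinuousLinearMap.adjoint P.A z, x - x'⟫ ≤ 0)
    (hy : β • (y - y') + P.K x' ∈ convexSubdiff (conj P.f) y')
    (hyb : conj P.f y = b) (hyb' : conj P.f y' = b')
    (hz : P.A x + α • z₀ - (α + c) • z ∈ convexSubdiff (conj P.g) z)
    (hz' : P.A x' + α • z - (α + c) • z' ∈ convexSubdiff (conj P.g) z') :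
    P.realMerit α (α + c) x' y' z' z ≤ P.realMerit α (α + c) x y z z₀
      - μ * ‖x' - x‖ ^ 2 - β * ‖y' - y‖ ^ 2 - α * ‖z' - z‖ ^ 2 := by
  obtain ⟨g, hg⟩ := exists_coe_of_mem_convexSubdiff hz
  obtain ⟨g', hg'⟩ := exists_coe_of_mem_convexSubdiff hz'
  have h2 := subgradient_ineq hy hyb' hyb
  have h3 := subgradient_ineq hz hg hg'
  have h4 := convexSubdiff_monotone hz' hz
  obtain ⟨dx, rfl⟩ : ∃ dx, x' = x + dx := ⟨x' - x, by abel⟩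
  obtain ⟨dy, rfl⟩ : ∃ dy, y' = y + dy := ⟨y' - y, by abel⟩
  obtain ⟨d, rfl⟩ : ∃ d, z' = z + d := ⟨z' - z, by abel⟩
  obtain ⟨e, rfl⟩ : ∃ e, z₀ = z - e := ⟨z - z₀, by abel⟩
  have h1 := le_add_inner_gradient_add_sq hφ hlip x dx
  simp only [realMerit, smoothMerit, couplingCoeff, hg, hg', hyb, hyb', EReal.toReal_coe]
  simp only [add_sub_cancel_left, sub_add_cancel_left, smul_neg, inner_neg_right, map_add,
    smul_add, smul_sub, sub_sub_cancel] at *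
  have eA : ⟪d, P.A dx⟫ = ⟪P.A dx, d⟫ := real_inner_comm _ _
  have eAx : ⟪d, P.A x⟫ = ⟪P.A x, d⟫ := real_inner_comm _ _
  have eK : ⟪P.K dx, y⟫ = ⟪y, P.K dx⟫ := real_inner_comm _ _
  have est := coupling_estimate (i := ⟪P.A dx, d⟫) (j := ⟪e, d⟫) hα hc hcγ hαγ (norm_nonneg d)
    (norm_nonneg e) (norm_nonneg (P.A dx)) (real_inner_le_norm _ _) (real_inner_le_norm _ _) (by
      rw [← real_inner_self_eq_norm_sq]
      simp only [inner_add_left, inner_sub_left, real_inner_smul_left] at h4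
      linarith)
  have hA : 3 * γ / (2 * c ^ 2) * ‖P.A dx‖ ^ 2 ≤
      3 * γ * ‖P.A‖ ^ 2 / (2 * c ^ 2) * ‖dx‖ ^ 2 := by
    have h5 : ‖P.A dx‖ ^ 2 ≤ (‖P.A‖ * ‖dx‖) ^ 2 :=
      pow_le_pow_left₀ (norm_nonneg _) (P.A.le_opNorm dx) 2
    have h6 : 0 ≤ 3 * γ / (2 * c ^ 2) := by
      have : 0 ≤ γ := by linarith
      positivity
    refine (mul_le_mul_of_nonneg_left h5 h6).trans (le_of_eq (by ring))
  have hn : ‖z + d‖ ^ 2 = ‖z‖ ^ 2 + 2 * ⟪z, d⟫ + ‖d‖ ^ 2 := norm_add_sq_real z d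
  rw [hn]
  simp only [inner_add_left, inner_sub_left, inner_add_right, inner_neg_left, real_inner_smul_left,
    ContinuousLinearMap.adjoint_inner_left, real_inner_self_eq_norm_sq, eA, eAx, eK] at *
  rw [hρ] at hx
  linarith

/-- The merit function has a Fréchet subgradient at the new iterate whose norm is controlled by
the length of the step. -/
theorem exists_frechetSubdiff_norm_le (hg_proper : IsProper P.g) (hg_conv : IsConvexFun P.g)
    (hg_lsc : LowerSemicontinuous P.g) (hg_strict : IsEssStrictlyConvex P.g)
    (hf_proper : IsProper P.f) (hφ : Differentiable ℝ P.phi) {ℓ : ℝ≥0}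
    (hlip : LipschitzWith ℓ (gradient P.phi)) {α c ρ β β' : ℝ} (hα : 0 < α) (hc : 0 < c)
    (hρ : 0 ≤ ρ) (hβ : 0 ≤ β) (hβ' : β ≤ β')
    {x x' : EuclideanSpace ℝ (Fin n)} {y y' : EuclideanSpace ℝ (Fin p)}
    {z z' : EuclideanSpace ℝ (Fin s)} (hxS : x' ∈ P.S)
    (hx : ∀ q ∈ P.S, ⟪ρ • (x - x') - gradient P.phi x + ContinuousLinearMap.adjoint P.K y
      - ContinuousLinearMap.adjoint P.A z, q - x'⟫ ≤ 0)
    (hy : β • (y - y') + P.K x' ∈ convexSubdiff (conj P.f) y')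
    (hz' : P.A x' + α • z - (α + c) • z' ∈ convexSubdiff (conj P.g) z') :
    ∃ v ∈ frechetSubdiff (P.merit α (α + c)) (point x' y' z' z),
      ‖v‖ ≤ (ρ + ℓ + ‖P.A‖ + ‖P.K‖ + β' + α + 4 * couplingCoeff α (α + c)) *
        (‖x' - x‖ + ‖y' - y‖ + ‖z' - z‖) := by
  refine ⟨_, mem_frechetSubdiff_merit (w := point x' y' z' z) hg_proper hg_conv hg_lsc hg_strict
    hf_proper hφ α (α + c) hxS hx hy hz', (norm_point_le _ _ _ _).trans ?_⟩
  have e1 : (point x' y' z' z).fst = x' := rfl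
  have e2 : (point x' y' z' z).snd.fst = y' := rfl
  have e3 : (point x' y' z' z).snd.snd.fst = z' := rfl
  have e4 : (point x' y' z' z).snd.snd.snd = z := rfl
  rw [e1, e2, e3, e4]
  have hκ : 0 ≤ couplingCoeff α (α + c) := by
    rw [couplingCoeff, add_sub_cancel_left]; positivity
  set κ := couplingCoeff α (α + c) with hκdef
  have n1 : gradient P.phi x' + ContinuousLinearMap.adjoint P.A z' -
      ContinuousLinearMap.adjoint P.K y' + (ρ • (x - x') - gradient P.phi x +
        ContinuousLinearMap.adjoint P.K y - ContinuousLinearMap.adjoint P.A z) =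
      (gradient P.phi x' - gradient P.phi x) - ρ • (x' - x)
        + ContinuousLinearMap.adjoint P.A (z' - z)
        - ContinuousLinearMap.adjoint P.K (y' - y) := by
    rw [map_sub, map_sub]; module
  have n2 : -P.K x' + (β • (y - y') + P.K x') = -(β • (y' - y)) := by module
  have n3 : P.A x' + (2 * κ) • (z' - z) - (α + c - α) • z' - (P.A x' + α • z - (α + c) • z') =
      (2 * κ + α) • (z' - z) := by module
  rw [n1, n2, n3, norm_neg, norm_neg, norm_smul, norm_smul, norm_smul, Real.norm_of_nonneg hβ,
    Real.norm_of_nonneg (by positivity : 0 ≤ 2 * κ + α),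
    Real.norm_of_nonneg (by positivity : 0 ≤ 2 * κ)]
  have b1 : ‖gradient P.phi x' - gradient P.phi x‖ ≤ ℓ * ‖x' - x‖ := by
    simpa [dist_eq_norm] using hlip.dist_le_mul x' x
  have b2 : ‖ContinuousLinearMap.adjoint P.A (z' - z)‖ ≤ ‖P.A‖ * ‖z' - z‖ := by
    simpa using (ContinuousLinearMap.adjoint P.A).le_opNorm (z' - z)
  have b3 : ‖ContinuousLinearMap.adjoint P.K (y' - y)‖ ≤ ‖P.K‖ * ‖y' - y‖ := by
    simpa using (ContinuousLinearMap.adjoint P.K).le_opNorm (y' - y)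
  have b4 : ‖(gradient P.phi x' - gradient P.phi x) - ρ • (x' - x)
        + ContinuousLinearMap.adjoint P.A (z' - z)
        - ContinuousLinearMap.adjoint P.K (y' - y)‖ ≤
      ℓ * ‖x' - x‖ + ρ * ‖x' - x‖ + ‖P.A‖ * ‖z' - z‖ + ‖P.K‖ * ‖y' - y‖ := by
    refine (norm_sub_le _ _).trans (add_le_add ((norm_add_le _ _).trans
      (add_le_add ((norm_sub_le _ _).trans (add_le_add b1 ?_)) b2)) b3)
    rw [norm_smul, Real.norm_of_nonneg hρ]
  have hX := norm_nonneg (x' - x)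
  have hY := norm_nonneg (y' - y)
  have hZ := norm_nonneg (z' - z)
  have hℓ : (0 : ℝ) ≤ ℓ := ℓ.2
  have hAn := norm_nonneg P.A
  have hKn := norm_nonneg P.K
  have b5 : β * ‖y' - y‖ ≤ β' * ‖y' - y‖ := mul_le_mul_of_nonneg_right hβ' hY
  have hβ'' : 0 ≤ β' := hβ.trans hβ'
  have : 0 ≤ (‖P.A‖ + ‖P.K‖ + β' + α + 4 * κ) * ‖x' - x‖ +
      (ρ + ℓ + ‖P.A‖ + α + 4 * κ) * ‖y' - y‖ + (ρ + ℓ + ‖P.K‖ + β') * ‖z' - z‖ := by positivity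
  linarith

end DCProgram

/-! ### The iteration with a constant parameter -/

theorem frechetSubdiff_subset_limitingSubdiff {E : Type*} [NormedAddCommGroup E]
    [InnerProductSpace ℝ E] (h : E → EReal) (x : E) :
    frechetSubdiff h x ⊆ limitingSubdiff h x := fun v hv =>
  ⟨hv.1, hv.2.1, fun _ => x, fun _ => v, tendsto_const_nhds, tendsto_const_nhds,
    tendsto_const_nhds, fun _ => hv⟩

/-- The Łojasiewicz inequality in real terms at a point with a subgradient `v`. -/
theorem rpow_le_of_one_le_mul {E : Type*} [NormedAddCommGroup E] {T : Set E} {v : E} (hv : v ∈ T)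
    {σ θ e : ℝ} (hσ : 0 < σ) (hθ : θ < 1) (he : 0 < e)
    (h : 1 ≤ ENNReal.ofReal (deriv (fun t : ℝ => σ / (1 - θ) * t ^ (1 - θ)) e) *
      Metric.infEDist (0 : E) T) : e ^ θ ≤ σ * ‖v‖ := by
  have hd : deriv (fun t : ℝ => σ / (1 - θ) * t ^ (1 - θ)) e = σ * e ^ (-θ) := by
    have h1 := (Real.hasDerivAt_rpow_const (p := 1 - θ) (Or.inl he.ne')).const_mul (σ / (1 - θ))
    rw [h1.deriv, ← mul_assoc, div_mul_cancel₀ _ (sub_pos.2 hθ).ne']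
    congr 2
    ring
  have h2 : Metric.infEDist (0 : E) T ≤ ENNReal.ofReal ‖v‖ := by
    refine (Metric.infEDist_le_edist_of_mem hv).trans (le_of_eq ?_)
    rw [edist_comm, edist_dist, dist_zero_right]
  have hpos : 0 < e ^ (-θ) := by positivity
  have h3 := h.trans (mul_le_mul_right h2 _)
  rw [hd, ← ENNReal.ofReal_mul (by positivity), ENNReal.one_le_ofReal] at h3
  have h4 : e ^ θ * e ^ (-θ) = 1 := by rw [← Real.rpow_add he]; simp
  refine le_of_mul_le_mul_right ?_ hpos
  linarith

open DCProgram

/-- The optimality conditions which the iterates satisfy from the index `N` on, once the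
parameters `α_k` and `ρ_k` have reached their final values `α + c` and `ρ`. -/
structure IsFixedParameterRun {n p s : ℕ} (P : DCProgram n p s) (α c ρ : ℝ) (L : ℝ) (βs : ℕ → ℝ)
    (x : ℕ → EuclideanSpace ℝ (Fin n)) (y : ℕ → EuclideanSpace ℝ (Fin p))
    (z : ℕ → EuclideanSpace ℝ (Fin s)) (N : ℕ) : Prop where
  mem : ∀ k, N ≤ k → x k ∈ P.S
  x_opt : ∀ k, N ≤ k → ∀ q ∈ P.S, ⟪ρ • (x k - x (k + 1)) - gradient P.phi (x k)
    + ContinuousLinearMap.adjoint P.K (y k) - ContinuousLinearMap.adjoint P.A (z k),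
    q - x (k + 1)⟫ ≤ 0
  y_opt : ∀ k, N ≤ k →
    βs k • (y k - y (k + 1)) + P.K (x (k + 1)) ∈ convexSubdiff (conj P.f) (y (k + 1))
  z_opt : ∀ k, N ≤ k →
    P.A (x (k + 1)) + α • z k - (α + c) • z (k + 1) ∈ convexSubdiff (conj P.g) (z (k + 1))
  norm_z_le : ∀ k, N ≤ k → ‖z k‖ ≤ L

/-- The length of the step from the `k`-th iterate to the next. -/
noncomputable def stepLength {n p s : ℕ} (x : ℕ → EuclideanSpace ℝ (Fin n)) (y : ℕ → EuclideanSpace ℝ (Fin p))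
    (z : ℕ → EuclideanSpace ℝ (Fin s)) (k : ℕ) : ℝ :=
  ‖x (k + 1) - x k‖ + ‖y (k + 1) - y k‖ + ‖z (k + 1) - z k‖

/-- The value of the merit function at `(x k, y k, z k, z (k - 1))`; meaningful for `k ≥ 1`. -/
noncomputable def energy {n p s : ℕ} (P : DCProgram n p s) (α c : ℝ) (x : ℕ → EuclideanSpace ℝ (Fin n))
    (y : ℕ → EuclideanSpace ℝ (Fin p)) (z : ℕ → EuclideanSpace ℝ (Fin s)) (k : ℕ) : ℝ :=
  P.realMerit α (α + c) (x k) (y k) (z k) (z (k - 1))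

namespace IsFixedParameterRun

variable {n p s : ℕ} {P : DCProgram n p s} {α c ρ L : ℝ} {βs : ℕ → ℝ}
  {x : ℕ → EuclideanSpace ℝ (Fin n)} {y : ℕ → EuclideanSpace ℝ (Fin p)}
  {z : ℕ → EuclideanSpace ℝ (Fin s)} {N : ℕ}

theorem stepLength_nonneg (k : ℕ) : 0 ≤ stepLength x y z k := by
  unfold stepLength; positivity

theorem sufficient_decrease (run : IsFixedParameterRun P α c ρ L βs x y z N)
    (hφ : Differentiable ℝ P.phi) {ℓ : ℝ≥0} (hlip : LipschitzWith ℓ (gradient P.phi))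
    {γ μ βlow : ℝ} (hα : 0 < α) (hc : 0 < c) (hcγ : c ≤ γ) (hαγ : α < γ / 2)
    (hρ : ρ = ℓ / 2 + 3 * γ * ‖P.A‖ ^ 2 / (2 * c ^ 2) + μ) (hμ : 0 < μ) (hβlow : 0 < βlow)
    (hβ : ∀ k, βlow ≤ βs k)
    {k : ℕ} (hk : N < k) :
    min μ (min βlow α) / 3 * stepLength x y z k ^ 2 ≤
      energy P α c x y z k - energy P α c x y z (k + 1) := by
  obtain ⟨k, rfl⟩ : ∃ j, k = j + 1 := ⟨k - 1, by lia⟩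
  obtain ⟨b, hb⟩ := exists_coe_of_mem_convexSubdiff (run.y_opt k (by lia))
  obtain ⟨b', hb'⟩ := exists_coe_of_mem_convexSubdiff (run.y_opt (k + 1) (by lia))
  have h := realMerit_step_le hφ hlip hα hc hcγ hαγ hρ
    (run.x_opt (k + 1) (by lia) _ (run.mem (k + 1) (by lia))) (run.y_opt (k + 1) (by lia)) hb hb'
    (run.z_opt k (by lia)) (run.z_opt (k + 1) (by lia))
  simp only [energy, stepLength, Nat.add_sub_cancel]
  set m := min μ (min βlow α)
  have m1 : m ≤ μ := min_le_left _ _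
  have m2 : m ≤ βs (k + 1) := (min_le_right _ _).trans ((min_le_left _ _).trans (hβ _))
  have m3 : m ≤ α := (min_le_right _ _).trans (min_le_right _ _)
  have e1 := mul_le_mul_of_nonneg_right m1 (sq_nonneg ‖x (k + 1 + 1) - x (k + 1)‖)
  have e2 := mul_le_mul_of_nonneg_right m2 (sq_nonneg ‖y (k + 1 + 1) - y (k + 1)‖)
  have e3 := mul_le_mul_of_nonneg_right m3 (sq_nonneg ‖z (k + 1 + 1) - z (k + 1)‖)
  generalize ‖x (k + 1 + 1) - x (k + 1)‖ = X at *
  generalize ‖y (k + 1 + 1) - y (k + 1)‖ = Y at *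
  generalize ‖z (k + 1 + 1) - z (k + 1)‖ = Z at *
  have hm : 0 ≤ m := (lt_min hμ (lt_min hβlow hα)).le
  have e4 : (X + Y + Z) ^ 2 ≤ 3 * (X ^ 2 + Y ^ 2 + Z ^ 2) := by
    nlinarith [sq_nonneg (X - Y), sq_nonneg (Y - Z), sq_nonneg (X - Z)]
  have e5 := mul_le_mul_of_nonneg_left e4 (div_nonneg hm (by norm_num : (0 : ℝ) ≤ 3))
  linarith

/-- Along the iteration the merit function is coercive in `y`. -/
theorem exists_energy_ge (run : IsFixedParameterRun P α c ρ L βs x y z N)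
    (hS_comp : IsCompact P.S) (hφ : Differentiable ℝ P.phi) (hα : 0 < α) (hc : 0 < c)
    (hf_proper : IsProper P.f) (hf_conv : IsConvexFun P.f)
    (hKS : P.K '' P.S ⊆ interior (effDom P.f)) :
    ∃ δ M : ℝ, 0 < δ ∧ ∀ k, N < k → δ * ‖y k‖ - M ≤ energy P α c x y z k := by
  obtain ⟨δ, M₁, hδ, hcoer⟩ := exists_conj_coercive hf_conv hf_proper
    (hS_comp.image P.K.continuous) hKS
  obtain ⟨m, hm⟩ := (hS_comp.image hφ.continuous).bddBelow
  obtain ⟨B, hB⟩ := (hS_comp.image P.A.continuous).isBounded.exists_norm_le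
  obtain ⟨g₀, hg₀⟩ := exists_coe_of_mem_convexSubdiff (run.z_opt N le_rfl)
  refine ⟨δ, M₁ - m + L * B + g₀ + (B + α * L + (α + c) * L) * (2 * L) + c / 2 * L ^ 2, hδ,
    fun k hk => ?_⟩
  obtain ⟨k, rfl⟩ : ∃ j, k = j + 1 := ⟨k - 1, by lia⟩
  obtain ⟨b, hb⟩ := exists_coe_of_mem_convexSubdiff (run.y_opt k (by lia))
  obtain ⟨g, hg⟩ := exists_coe_of_mem_convexSubdiff (run.z_opt k (by lia))
  have hxS := run.mem (k + 1) (by lia)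
  have hzL := run.norm_z_le (k + 1) (by lia)
  have hzL' := run.norm_z_le k (by lia)
  have hz0L := run.norm_z_le (N + 1) (by lia)
  have hL : 0 ≤ L := (norm_nonneg _).trans hzL
  have hA : ‖P.A (x (k + 1))‖ ≤ B := hB _ (mem_image_of_mem _ hxS)
  have hB0 : 0 ≤ B := (norm_nonneg _).trans hA
  have h1 := hcoer _ (mem_image_of_mem _ hxS) (y (k + 1))
  rw [hb, EReal.coe_le_coe_iff] at h1
  have h2 : m ≤ P.phi (x (k + 1)) := hm (mem_image_of_mem _ hxS)
  have h3 : -(L * B) ≤ ⟪z (k + 1), P.A (x (k + 1))⟫ := by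
    have := (abs_le.1 (abs_real_inner_le_norm (z (k + 1)) (P.A (x (k + 1))))).1
    have := mul_le_mul hzL hA (norm_nonneg _) hL
    linarith
  have h4 : g ≤ g₀ + (B + α * L + (α + c) * L) * (2 * L) := by
    have h5 := subgradient_ineq (run.z_opt k (by lia)) hg hg₀
    have h6 := (abs_le.1 (abs_real_inner_le_norm
      (P.A (x (k + 1)) + α • z k - (α + c) • z (k + 1)) (z (N + 1) - z (k + 1)))).1
    have h7 : ‖P.A (x (k + 1)) + α • z k - (α + c) • z (k + 1)‖ ≤ B + α * L + (α + c) * L := by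
      refine (norm_sub_le _ _).trans (add_le_add ((norm_add_le _ _).trans (add_le_add hA ?_)) ?_)
      · rw [norm_smul, Real.norm_of_nonneg hα.le]
        exact mul_le_mul_of_nonneg_left hzL' hα.le
      · rw [norm_smul, Real.norm_of_nonneg (by positivity)]
        exact mul_le_mul_of_nonneg_left hzL (by positivity)
    have h8 : ‖z (N + 1) - z (k + 1)‖ ≤ 2 * L := (norm_sub_le _ _).trans (by linarith)
    have h9 := mul_le_mul h7 h8 (norm_nonneg _) (by positivity)
    linarith
  have h10 : ‖z (k + 1)‖ ^ 2 ≤ L ^ 2 := pow_le_pow_left₀ (norm_nonneg _) hzL 2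
  have h11 : c / 2 * ‖z (k + 1)‖ ^ 2 ≤ c / 2 * L ^ 2 :=
    mul_le_mul_of_nonneg_left h10 (by positivity)
  have h12 : 0 ≤ couplingCoeff α (α + c) * ‖z (k + 1) - z k‖ ^ 2 := by
    rw [couplingCoeff, add_sub_cancel_left]; positivity
  simp only [energy, realMerit, smoothMerit, hb, hg, EReal.toReal_coe, Nat.add_sub_cancel,
    add_sub_cancel_left]
  linarith

/-- At a cluster point of the iterates the merit function is finite, has a subgradient, and is
the limit of the energies along the subsequence. -/
theorem cluster_point (run : IsFixedParameterRun P α c ρ L βs x y z N)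
    (hS_comp : IsCompact P.S) (hφ : Differentiable ℝ P.phi)
    (hg_proper : IsProper P.g) (hg_conv : IsConvexFun P.g) (hg_lsc : LowerSemicontinuous P.g)
    (hg_strict : IsEssStrictlyConvex P.g)
    (hf_proper : IsProper P.f) (hf_conv : IsConvexFun P.f) (hf_lsc : LowerSemicontinuous P.f)
    {βlow βup : ℝ} (hβlow : 0 < βlow) (hβ : ∀ k, βlow ≤ βs k ∧ βs k ≤ βup)
    {κ : ℕ → ℕ} (hκN : ∀ j, N ≤ κ j)
    (hstep : Tendsto (fun j => stepLength x y z (κ j)) atTop (𝓝 0))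
    {xl : EuclideanSpace ℝ (Fin n)} {yl : EuclideanSpace ℝ (Fin p)} {zl : EuclideanSpace ℝ (Fin s)}
    (hx : Tendsto (fun j => x (κ j + 1)) atTop (𝓝 xl))
    (hy : Tendsto (fun j => y (κ j + 1)) atTop (𝓝 yl))
    (hz : Tendsto (fun j => z (κ j + 1)) atTop (𝓝 zl)) :
    Tendsto (fun j => z (κ j)) atTop (𝓝 zl) ∧
    (limitingSubdiff (P.merit α (α + c)) (point xl yl zl zl)).Nonempty ∧
    ∃ e : ℝ, P.merit α (α + c) (point xl yl zl zl) = e ∧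
      Tendsto (fun j => energy P α c x y z (κ j + 1)) atTop (𝓝 e) := by
  have hxl : xl ∈ P.S := hS_comp.isClosed.mem_of_tendsto hx
    (Eventually.of_forall fun j => run.mem _ (by have := hκN j; lia))
  have hdz : Tendsto (fun j => z (κ j + 1) - z (κ j)) atTop (𝓝 0) := by
    refine squeeze_zero_norm (fun j => ?_) hstep
    unfold stepLength
    linarith [norm_nonneg (x (κ j + 1) - x (κ j)), norm_nonneg (y (κ j + 1) - y (κ j))]
  have hdy : Tendsto (fun j => βs (κ j) • (y (κ j) - y (κ j + 1))) atTop (𝓝 0) := by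
    refine squeeze_zero_norm (a := fun j => βup * stepLength x y z (κ j)) (fun j => ?_) ?_
    · have hb := hβ (κ j)
      rw [norm_smul, Real.norm_of_nonneg (by linarith), norm_sub_rev]
      refine mul_le_mul hb.2 ?_ (norm_nonneg _) (by linarith)
      unfold stepLength
      linarith [norm_nonneg (x (κ j + 1) - x (κ j)), norm_nonneg (z (κ j + 1) - z (κ j))]
    · simpa using hstep.const_mul βup
  have hz' : Tendsto (fun j => z (κ j)) atTop (𝓝 zl) := by
    simpa using hz.sub hdz
  have hv : Tendsto (fun j => βs (κ j) • (y (κ j) - y (κ j + 1)) + P.K (x (κ j + 1))) atTop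
      (𝓝 (P.K xl)) := by
    simpa using hdy.add ((P.K.continuous.tendsto xl).comp hx)
  have hξ : Tendsto (fun j => P.A (x (κ j + 1)) + α • z (κ j) - (α + c) • z (κ j + 1)) atTop
      (𝓝 (P.A xl + α • zl - (α + c) • zl)) :=
    (((P.A.continuous.tendsto xl).comp hx).add (hz'.const_smul α)).sub (hz.const_smul (α + c))
  choose b hb using fun j => exists_coe_of_mem_convexSubdiff (run.y_opt (κ j) (hκN j))
  choose g hg using fun j => exists_coe_of_mem_convexSubdiff (run.z_opt (κ j) (hκN j))
  obtain ⟨bl, hbl, hbsub, hblim⟩ := mem_convexSubdiff_of_tendsto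
    (isProper_conj hf_conv hf_proper hf_lsc) (lowerSemicontinuous_conj hf_proper.2)
    (fun j => run.y_opt (κ j) (hκN j)) hb hy hv
  obtain ⟨gl, hgl, hgsub, hglim⟩ := mem_convexSubdiff_of_tendsto
    (isProper_conj hg_conv hg_proper hg_lsc) (lowerSemicontinuous_conj hg_proper.2)
    (fun j => run.z_opt (κ j) (hκN j)) hg hz hξ
  have hfr := mem_frechetSubdiff_merit (w := point xl yl zl zl) (ν := 0) hg_proper hg_conv hg_lsc
    hg_strict hf_proper hφ α (α + c) hxl (fun q _ => by rw [inner_zero_left]) hbsub hgsub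
  have hval := merit_point_eq_coe (α := α) (αfin := α + c) zl hxl hbl hgl
  refine ⟨hz', ⟨_, frechetSubdiff_subset_limitingSubdiff _ _ hfr⟩, _, hval, ?_⟩
  simp only [energy, realMerit, hb, hg, hbl, hgl, EReal.toReal_coe, Nat.add_sub_cancel]
  refine Tendsto.add (Tendsto.sub ?_ hglim) hblim
  have hcont : Continuous fun w : EuclideanSpace ℝ (Fin n) × EuclideanSpace ℝ (Fin p) ×
      EuclideanSpace ℝ (Fin s) × EuclideanSpace ℝ (Fin s) =>
        P.smoothMerit α (α + c) w.1 w.2.1 w.2.2.1 w.2.2.2 := by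
    have := hφ.continuous
    unfold smoothMerit
    fun_prop
  have hlim := (hcont.tendsto (xl, yl, zl, zl)).comp
    (hx.prodMk_nhds (hy.prodMk_nhds (hz.prodMk_nhds hz')))
  simp only [Function.comp_def] at hlim
  exact hlim

/-- The Łojasiewicz inequality holds along the iterates with one constant. If the constants
`i + 1`, `i ∈ ℕ`, failed infinitely often, then a cluster point of the offending iterates would
violate the Kurdyka–Łojasiewicz property there. -/
theorem exists_lojasiewicz_constant (run : IsFixedParameterRun P α c ρ L βs x y z N)
    (hS_comp : IsCompact P.S) (hφ : Differentiable ℝ P.phi) {ℓ : ℝ≥0}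
    (hlip : LipschitzWith ℓ (gradient P.phi))
    (hg_proper : IsProper P.g) (hg_conv : IsConvexFun P.g) (hg_lsc : LowerSemicontinuous P.g)
    (hg_strict : IsEssStrictlyConvex P.g)
    (hf_proper : IsProper P.f) (hf_conv : IsConvexFun P.f) (hf_lsc : LowerSemicontinuous P.f)
    (hα : 0 < α) (hc : 0 < c) (hρ : 0 ≤ ρ)
    {βlow βup : ℝ} (hβlow : 0 < βlow) (hβ : ∀ k, βlow ≤ βs k ∧ βs k ≤ βup)
    (hstep : Tendsto (stepLength x y z) atTop (𝓝 0)) {Y : ℝ} (hY : ∀ k, N < k → ‖y k‖ ≤ Y)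
    {e : ℝ} (hlim : Tendsto (energy P α c x y z) atTop (𝓝 e)) {θ : ℝ} (hθ : θ < 1)
    (hKL : ∀ w : Space4 n p s, (limitingSubdiff (P.merit α (α + c)) w).Nonempty →
      ∃ σ : ℝ, 0 < σ ∧
        HasKLWith (P.merit α (α + c)) w (fun t : ℝ => σ / (1 - θ) * t ^ (1 - θ))) :
    ∃ (C : ℝ) (N' : ℕ), 0 < C ∧ ∀ k, N' ≤ k → 0 < energy P α c x y z (k + 1) - e →
      (energy P α c x y z (k + 1) - e) ^ θ ≤ C * stepLength x y z k := by
  by_contra! hcon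
  have hex : ∀ i : ℕ, ∃ k, i + N ≤ k ∧ 0 < energy P α c x y z (k + 1) - e ∧
      ((i : ℝ) + 1) * stepLength x y z k < (energy P α c x y z (k + 1) - e) ^ θ :=
    fun i => hcon (i + 1) (i + N) (by positivity)
  choose κ hκ hpos hfail using hex
  obtain ⟨X, hX⟩ := hS_comp.isBounded.exists_norm_le
  have hbdd : Bornology.IsBounded (Metric.closedBall (0 : EuclideanSpace ℝ (Fin n)) X ×ˢ
      (Metric.closedBall (0 : EuclideanSpace ℝ (Fin p)) Y ×ˢ
        Metric.closedBall (0 : EuclideanSpace ℝ (Fin s)) L)) :=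
    Metric.isBounded_closedBall.prod (Metric.isBounded_closedBall.prod Metric.isBounded_closedBall)
  obtain ⟨⟨xl, yl, zl⟩, -, ψ, hψ, hψlim⟩ := tendsto_subseq_of_bounded hbdd
    (x := fun i => (x (κ i + 1), y (κ i + 1), z (κ i + 1))) fun i => by
      have := hκ i
      simp only [mem_prod, mem_closedBall_zero_iff]
      exact ⟨hX _ (run.mem _ (by lia)), hY _ (by lia), run.norm_z_le _ (by lia)⟩
  have hx : Tendsto (fun j => x (κ (ψ j) + 1)) atTop (𝓝 xl) :=
    (continuous_fst.tendsto _).comp hψlim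
  have hy : Tendsto (fun j => y (κ (ψ j) + 1)) atTop (𝓝 yl) :=
    ((continuous_fst.comp continuous_snd).tendsto _).comp hψlim
  have hz : Tendsto (fun j => z (κ (ψ j) + 1)) atTop (𝓝 zl) :=
    ((continuous_snd.comp continuous_snd).tendsto _).comp hψlim
  have hκψ : Tendsto (fun j => κ (ψ j)) atTop atTop :=
    tendsto_atTop_mono (fun j => by have := hκ (ψ j); lia) hψ.tendsto_atTop
  obtain ⟨hz', hne, e', he', hlim'⟩ := run.cluster_point (κ := fun j => κ (ψ j)) hS_comp hφ
    hg_proper hg_conv hg_lsc hg_strict hf_proper hf_conv hf_lsc hβlow hβ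
    (fun j => by have := hκ (ψ j); lia) (hstep.comp hκψ) hx hy hz
  have hκψ1 : Tendsto (fun j => κ (ψ j) + 1) atTop atTop := (tendsto_add_atTop_nat 1).comp hκψ
  have hsub := hlim.comp hκψ1
  obtain rfl : e' = e := tendsto_nhds_unique hlim' hsub
  obtain ⟨σ, hσ, η, hη, -, U, hU, hwU, hineq⟩ := hKL _ hne
  have hpt : Tendsto (fun j => point (x (κ (ψ j) + 1)) (y (κ (ψ j) + 1)) (z (κ (ψ j) + 1))
      (z (κ (ψ j)))) atTop (𝓝 (point xl yl zl zl)) := by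
    have := (continuous_point.tendsto (xl, yl, zl, zl)).comp
      (hx.prodMk_nhds (hy.prodMk_nhds (hz.prodMk_nhds hz')))
    simpa only [Function.comp_def] using this
  have hη' : ∀ᶠ j in atTop, ((energy P α c x y z (κ (ψ j) + 1) : ℝ) : EReal) < e' + η := by
    have h1 : (e' : EReal) < e' + η := by
      have := EReal.add_lt_add_left_coe hη e'
      simpa using this
    exact ((continuous_coe_real_ereal.tendsto e').comp hlim').eventually (gt_mem_nhds h1)
  set C₀ := ρ + ℓ + ‖P.A‖ + ‖P.K‖ + βup + α + 4 * couplingCoeff α (α + c) with hC₀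
  obtain ⟨j, ⟨hjU, hjη⟩, hjC⟩ := (((hpt.eventually (hU.mem_nhds hwU)).and hη').and
    (tendsto_natCast_atTop_atTop.eventually_ge_atTop (σ * C₀))).exists
  have hκj := hκ (ψ j)
  have hβj := hβ (κ (ψ j))
  obtain ⟨b, hb⟩ := exists_coe_of_mem_convexSubdiff (run.y_opt (κ (ψ j)) (by lia))
  obtain ⟨g, hg⟩ := exists_coe_of_mem_convexSubdiff (run.z_opt (κ (ψ j)) (by lia))
  have hval : P.merit α (α + c) (point (x (κ (ψ j) + 1)) (y (κ (ψ j) + 1)) (z (κ (ψ j) + 1))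
      (z (κ (ψ j)))) = ((energy P α c x y z (κ (ψ j) + 1) : ℝ) : EReal) :=
    merit_point_eq_coe (α := α) (αfin := α + c) (z (κ (ψ j)))
      (run.mem (κ (ψ j) + 1) (by lia)) hb hg
  obtain ⟨v, hv, hvn⟩ := exists_frechetSubdiff_norm_le hg_proper hg_conv hg_lsc hg_strict
    hf_proper hφ hlip hα hc hρ (hβlow.le.trans hβj.1) hβj.2 (run.mem (κ (ψ j) + 1) (by lia))
    (run.x_opt (κ (ψ j)) (by lia)) (run.y_opt (κ (ψ j)) (by lia)) (run.z_opt (κ (ψ j)) (by lia))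
  have h1 := hineq _ hjU (by rw [hval, he', EReal.coe_lt_coe_iff]; linarith [hpos (ψ j)])
    (by rw [hval, he']; exact hjη)
  rw [hval, he', EReal.toReal_coe, EReal.toReal_coe] at h1
  have h2 := rpow_le_of_one_le_mul (frechetSubdiff_subset_limitingSubdiff _ _ hv) hσ hθ
    (hpos (ψ j)) h1
  have h3 : σ * ‖v‖ ≤ σ * (C₀ * stepLength x y z (κ (ψ j))) :=
    mul_le_mul_of_nonneg_left hvn hσ.le
  have h4 : σ * C₀ ≤ (ψ j : ℝ) + 1 := by
    have : (j : ℝ) ≤ ψ j := by exact_mod_cast hψ.id_le j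
    linarith
  have h5 := mul_le_mul_of_nonneg_right h4
    (stepLength_nonneg (x := x) (y := y) (z := z) (κ (ψ j)))
  linarith [hfail (ψ j)]

/-- Convergence of the iterates, with the remaining length `R` of the trajectory as error bound.
The energies decrease and are bounded below, so the steps tend to zero and the Łojasiewicz
inequality applies. -/
theorem exists_limit (run : IsFixedParameterRun P α c ρ L βs x y z N)
    (hS_comp : IsCompact P.S) (hφ : Differentiable ℝ P.phi) {ℓ : ℝ≥0}
    (hlip : LipschitzWith ℓ (gradient P.phi))
    (hg_proper : IsProper P.g) (hg_conv : IsConvexFun P.g) (hg_lsc : LowerSemicontinuous P.g)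
    (hg_strict : IsEssStrictlyConvex P.g)
    (hf_proper : IsProper P.f) (hf_conv : IsConvexFun P.f) (hf_lsc : LowerSemicontinuous P.f)
    (hKS : P.K '' P.S ⊆ interior (effDom P.f))
    {γ μ : ℝ} (hα : 0 < α) (hc : 0 < c) (hcγ : c ≤ γ) (hαγ : α < γ / 2) (hμ : 0 < μ)
    (hρ : ρ = ℓ / 2 + 3 * γ * ‖P.A‖ ^ 2 / (2 * c ^ 2) + μ)
    {βlow βup : ℝ} (hβlow : 0 < βlow) (hβ : ∀ k, βlow ≤ βs k ∧ βs k ≤ βup)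
    {θ : ℝ} (hθ0 : 0 ≤ θ) (hθ : θ < 1)
    (hKL : ∀ w : Space4 n p s, (limitingSubdiff (P.merit α (α + c)) w).Nonempty →
      ∃ σ : ℝ, 0 < σ ∧
        HasKLWith (P.merit α (α + c)) w (fun t : ℝ => σ / (1 - θ) * t ^ (1 - θ))) :
    ∃ (xl : EuclideanSpace ℝ (Fin n)) (yl : EuclideanSpace ℝ (Fin p))
      (zl : EuclideanSpace ℝ (Fin s)) (R : ℕ → ℝ) (N' : ℕ),
      (Tendsto x atTop (𝓝 xl) ∧ Tendsto y atTop (𝓝 yl) ∧ Tendsto z atTop (𝓝 zl)) ∧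
      (∀ k, N' ≤ k → ‖x k - xl‖ ≤ R k ∧ ‖y k - yl‖ ≤ R k ∧ ‖z k - zl‖ ≤ R k) ∧
      (θ = 0 → ∃ k₁, ∀ k, k₁ ≤ k → R k = 0) ∧
      (0 < θ → θ ≤ 1 / 2 → ∃ (k₁ : ℕ) (q κ : ℝ), 0 < q ∧ q < 1 ∧ 0 < κ ∧
        ∀ k, k₁ ≤ k → R k ≤ κ * q ^ k) ∧
      (1 / 2 < θ → ∃ (k₁ : ℕ) (κ : ℝ), 0 < κ ∧
        ∀ k : ℕ, k₁ ≤ k → R k ≤ κ * (k : ℝ) ^ (-((1 - θ) / (2 * θ - 1)))) := by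
  have hdec := fun k (hk : N < k) => run.sufficient_decrease hφ hlip hα hc hcγ hαγ hρ hμ hβlow
    (fun k => (hβ k).1) hk
  obtain ⟨δ, M, hδ, hlow⟩ := run.exists_energy_ge hS_comp hφ hα hc hf_proper hf_conv hKS
  set m := min μ (min βlow α) / 3 with hm
  have hm0 : 0 < m := div_pos (lt_min hμ (lt_min hβlow hα)) (by norm_num)
  have hanti : Antitone fun k => energy P α c x y z (k + (N + 1)) :=
    antitone_nat_of_succ_le fun k => by
      have := hdec (k + (N + 1)) (by lia)
      have h2 : 0 ≤ m * stepLength x y z (k + (N + 1)) ^ 2 := by positivity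
      rw [show k + 1 + (N + 1) = k + (N + 1) + 1 by ring]
      linarith
  have hbdd : BddBelow (range fun k => energy P α c x y z (k + (N + 1))) := by
    refine ⟨-M, ?_⟩
    rintro _ ⟨k, rfl⟩
    have := hlow (k + (N + 1)) (by lia)
    have h2 : 0 ≤ δ * ‖y (k + (N + 1))‖ := by positivity
    dsimp only
    linarith
  obtain ⟨e, he⟩ : ∃ e, Tendsto (fun k => energy P α c x y z (k + (N + 1))) atTop (𝓝 e) :=
    ⟨_, tendsto_atTop_ciInf hanti hbdd⟩
  have hge : ∀ k, N < k → e ≤ energy P α c x y z k := fun k hk => by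
    have := hanti.le_of_tendsto he (k - (N + 1))
    rwa [Nat.sub_add_cancel hk] at this
  have hle : ∀ k, N < k → energy P α c x y z k ≤ energy P α c x y z (N + 1) := fun k hk => by
    have := hanti (Nat.zero_le (k - (N + 1)))
    simpa only [Nat.sub_add_cancel hk, zero_add] using this
  have hlim : Tendsto (energy P α c x y z) atTop (𝓝 e) := (tendsto_add_atTop_iff_nat _).1 he
  have hY : ∀ k, N < k → ‖y k‖ ≤ (energy P α c x y z (N + 1) + M) / δ := fun k hk => by
    rw [le_div_iff₀ hδ]
    linarith [hlow k hk, hle k hk]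
  have hstep : Tendsto (stepLength x y z) atTop (𝓝 0) := by
    have h1 : Tendsto (fun k => Real.sqrt ((energy P α c x y z k - energy P α c x y z (k + 1)) / m))
        atTop (𝓝 0) := by
      have := ((hlim.sub ((tendsto_add_atTop_iff_nat 1).2 hlim)).div_const m).sqrt
      simpa using this
    refine squeeze_zero' (Eventually.of_forall stepLength_nonneg) ?_ h1
    filter_upwards [eventually_gt_atTop N] with k hk
    refine Real.le_sqrt_of_sq_le ?_
    rw [le_div_iff₀ hm0, mul_comm]
    exact hdec k hk
  have hρ0 : 0 ≤ ρ := by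
    have : 0 ≤ γ := by linarith
    rw [hρ]; positivity
  obtain ⟨C, N₁, hC, hloj⟩ := run.exists_lojasiewicz_constant hS_comp hφ hlip hg_proper hg_conv
    hg_lsc hg_strict hf_proper hf_conv hf_lsc hα hc hρ0 hβlow hβ hstep hY hlim hθ hKL
  obtain ⟨R, hR0, hRsum, hRzero, hRlin, hRsub⟩ := exists_tail_bound
    (E := fun k => energy P α c x y z k - e) (D := stepLength x y z) (N := max (N + 1) N₁)
    hθ0 hθ hm0 hC stepLength_nonneg (fun k hk => sub_nonneg.2 (hge k (by lia)))
    (by simpa using hlim.sub_const e)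
    (fun k hk => by simpa using hdec k (by lia))
    (fun k hk => hloj k (by lia))
  have hxd : ∀ k, dist (x k) (x (k + 1)) ≤ stepLength x y z k := fun k => by
    rw [dist_comm, dist_eq_norm, stepLength]
    linarith [norm_nonneg (y (k + 1) - y k), norm_nonneg (z (k + 1) - z k)]
  have hyd : ∀ k, dist (y k) (y (k + 1)) ≤ stepLength x y z k := fun k => by
    rw [dist_comm, dist_eq_norm, stepLength]
    linarith [norm_nonneg (x (k + 1) - x k), norm_nonneg (z (k + 1) - z k)]
  have hzd : ∀ k, dist (z k) (z (k + 1)) ≤ stepLength x y z k := fun k => by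
    rw [dist_comm, dist_eq_norm, stepLength]
    linarith [norm_nonneg (x (k + 1) - x k), norm_nonneg (y (k + 1) - y k)]
  obtain ⟨xl, hxl, hxR⟩ := exists_limit_of_tail_bound hxd hR0 hRsum
  obtain ⟨yl, hyl, hyR⟩ := exists_limit_of_tail_bound hyd hR0 hRsum
  obtain ⟨zl, hzl, hzR⟩ := exists_limit_of_tail_bound hzd hR0 hRsum
  refine ⟨xl, yl, zl, R, max (N + 1) N₁ + 1, ⟨hxl, hyl, hzl⟩, fun k hk => ?_, hRzero, hRlin, hRsub⟩
  simp only [← dist_eq_norm]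
  exact ⟨hxR k (by lia), hyR k (by lia), hzR k (by lia)⟩

end IsFixedParameterRun

/-! ### The adaptive parameter -/

/-- A counter that moves by at most one at each step, and never moves while it is at least `J`,
is eventually constant. -/
theorem exists_eventually_const {m : ℕ → ℕ} {J : ℕ}
    (hm : ∀ k, m (k + 1) = m k ∨ m (k + 1) = m k + 1) (hJ : ∀ k, J ≤ m k → m (k + 1) = m k) :
    ∃ K, ∀ k, K ≤ k → m k = m K := by
  have hmono : Monotone m := monotone_nat_of_le_succ fun k => by rcases hm k with h | h <;> lia
  have hbdd : ∀ k, m k ≤ max (m 0) J := by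
    intro k
    induction k with
    | zero => exact le_max_left _ _
    | succ k ih =>
      by_cases h : J ≤ m k
      · rw [hJ k h]; exact ih
      · rcases hm k with h' | h' <;> lia
  have hbdd' : BddAbove (range m) := ⟨_, by rintro _ ⟨k, rfl⟩; exact hbdd k⟩
  obtain ⟨K, hK⟩ := Nat.sSup_mem (range_nonempty m) hbdd'
  refine ⟨K, fun k hk => le_antisymm ?_ (hmono hk)⟩
  rw [hK]
  exact le_csSup hbdd' (mem_range_self k)

theorem IsParameterList.le_add {α γ : ℝ} {a : ℕ → ℝ} (ha : IsParameterList α γ a) (j : ℕ) :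
    a j ≤ α + γ := ha.zero ▸ antitone_nat_of_succ_le ha.anti (Nat.zero_le j)

namespace IsAdaptiveDPFS

variable {n p s : ℕ} {P : DCProgram n p s} {ℓ α γ μ ε : ℝ} {a αs βs ρs δs : ℕ → ℝ}
  {x : ℕ → EuclideanSpace ℝ (Fin n)} {y : ℕ → EuclideanSpace ℝ (Fin p)}
  {z : ℕ → EuclideanSpace ℝ (Fin s)}

theorem lt_αs (halg : IsAdaptiveDPFS P ℓ α γ μ ε a αs βs ρs δs x y z)
    (ha : IsParameterList α γ a) (k : ℕ) : α < αs k := by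
  obtain ⟨m, -, hm, -⟩ := halg.α_rule
  rw [hm k]
  exact ha.gt _

theorem x_mem (halg : IsAdaptiveDPFS P ℓ α γ μ ε a αs βs ρs δs x y z) {k : ℕ} (hk : 0 < k) :
    x k ∈ P.S := by
  obtain ⟨k, rfl⟩ : ∃ j, k = j + 1 := ⟨k - 1, by lia⟩
  exact (halg.x_step k).1

theorem x_opt (halg : IsAdaptiveDPFS P ℓ α γ μ ε a αs βs ρs δs x y z) (hS : Convex ℝ P.S)
    {k : ℕ} (hρ : 0 < ρs k) {q : EuclideanSpace ℝ (Fin n)} (hq : q ∈ P.S) :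
    ⟪ρs k • (x k - x (k + 1)) - gradient P.phi (x k) + ContinuousLinearMap.adjoint P.K (y k)
      - ContinuousLinearMap.adjoint P.A (z k), q - x (k + 1)⟫ ≤ 0 := by
  have h := (halg.x_step k).inner_le_zero hS hq
  have e : ρs k • (x k - x (k + 1)) - gradient P.phi (x k) +
      ContinuousLinearMap.adjoint P.K (y k) - ContinuousLinearMap.adjoint P.A (z k) =
      ρs k • (x k + (1 / ρs k) • (-gradient P.phi (x k) + ContinuousLinearMap.adjoint P.K (y k)
      - ContinuousLinearMap.adjoint P.A (z k)) - x (k + 1)) := by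
    rw [add_sub_right_comm (x k), smul_add, smul_smul, mul_one_div_cancel hρ.ne', one_smul]
    abel
  rw [e, real_inner_smul_left]
  exact mul_nonpos_of_nonneg_of_nonpos hρ.le h

theorem y_opt (halg : IsAdaptiveDPFS P ℓ α γ μ ε a αs βs ρs δs x y z)
    (hf_proper : IsProper P.f) (hf_conv : IsConvexFun P.f) (hf_lsc : LowerSemicontinuous P.f)
    {k : ℕ} (hβ : 0 < βs k) :
    βs k • (y k - y (k + 1)) + P.K (x (k + 1)) ∈ convexSubdiff (conj P.f) (y (k + 1)) := by
  have h := (halg.y_step k).mem_convexSubdiff (isConvexFun_conj hf_proper)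
    (isProper_conj hf_conv hf_proper hf_lsc) (one_div_pos.2 hβ)
  rw [one_div_one_div, add_sub_right_comm, smul_add, smul_smul, mul_one_div_cancel hβ.ne',
    one_smul] at h
  exact h

theorem z_opt (halg : IsAdaptiveDPFS P ℓ α γ μ ε a αs βs ρs δs x y z)
    (hg_proper : IsProper P.g) (hg_conv : IsConvexFun P.g) (hg_lsc : LowerSemicontinuous P.g)
    {k : ℕ} (hα : 0 < αs k) :
    P.A (x (k + 1)) + α • z k - αs k • z (k + 1) ∈ convexSubdiff (conj P.g) (z (k + 1)) := by
  have h := (halg.z_step k).mem_convexSubdiff (isConvexFun_conj hg_proper)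
    (isProper_conj hg_conv hg_proper hg_lsc) (one_div_pos.2 hα)
  rw [one_div_one_div, smul_sub, smul_add, smul_smul, smul_smul, mul_one_div_cancel hα.ne',
    one_smul, halg.δ_rule k, mul_div_cancel₀ _ hα.ne', add_comm (α • z k)] at h
  exact h

/-- The dual iterates stay in the ball of radius `L`: `z (k+1)` is a subgradient of `g` at
`(A x + α z k) - α_k z (k+1)`, and `A x + α z k` lies inside the region where `g` is
`L`-Lipschitz, since `α L < r`. -/
theorem norm_z_le (halg : IsAdaptiveDPFS P ℓ α γ μ ε a αs βs ρs δs x y z)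
    (hg_proper : IsProper P.g) (hg_conv : IsConvexFun P.g) (hg_lsc : LowerSemicontinuous P.g)
    {r : ℝ} (hKr : P.enlargement r ⊆ interior (effDom P.g)) {L : ℝ≥0} (hL : 0 < L)
    (hg_lip : LipschitzOnWith L (fun v => (P.g v).toReal) (P.enlargement r))
    (hα : 0 < α) (hαγ : α < γ / 2) (hγ : γ ≤ 2 * r / L) (ha : IsParameterList α γ a)
    (hz0 : ‖z 0‖ ≤ L) (k : ℕ) : ‖z k‖ ≤ L := by
  have hL' : (0 : ℝ) < L := hL
  induction k with
  | zero => exact hz0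
  | succ k ih =>
    have hαk : 0 < αs k := hα.trans (halg.lt_αs ha k)
    have hsub := mem_convexSubdiff_of_conj hg_conv hg_proper hg_lsc
      (halg.z_opt hg_proper hg_conv hg_lsc hαk)
    refine norm_le_of_mem_convexSubdiff (T := P.enlargement r) hg_conv hg_proper.2 ?_
      (hKr.trans interior_subset) hg_lip hαk hsub
    have hαL : α * L < r := by
      have h1 : γ * L ≤ 2 * r := (le_div_iff₀ hL').1 hγ
      nlinarith
    have hd : Metric.infDist (P.A (x (k + 1)) + α • z k) (P.A '' P.S) < r := by
      refine (Metric.infDist_le_dist_of_mem (mem_image_of_mem P.A (halg.x_step k).1)).trans_lt ?_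
      rw [dist_eq_norm, add_sub_cancel_left, norm_smul, Real.norm_of_nonneg hα.le]
      exact (mul_le_mul_of_nonneg_left ih hα.le).trans_lt hαL
    filter_upwards [(Metric.continuous_infDist_pt (P.A '' P.S)).tendsto _ |>.eventually
      (gt_mem_nhds hd)] with v hv using le_of_lt hv

/-- The parameter `α_k` is eventually constant: once `(α_k - α) L ≤ ε` it no longer moves. -/
theorem exists_final_parameter (halg : IsAdaptiveDPFS P ℓ α γ μ ε a αs βs ρs δs x y z)
    (ha : IsParameterList α γ a) (hε : 0 < ε) {L : ℝ} (hz : ∀ k, ‖z k‖ ≤ L) :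
    ∃ K, ∀ k, K ≤ k → αs k = αs K ∧ (αs k - α) * ‖z (k + 1)‖ ≤ ε := by
  obtain ⟨m, -, hαs, hmove, hstay⟩ := halg.α_rule
  have hlim : Tendsto (fun j => (a j - α) * L) atTop (𝓝 0) := by
    simpa using (ha.tendsto.sub_const α).mul_const L
  obtain ⟨J, hJ⟩ := eventually_atTop.1 (hlim.eventually (gt_mem_nhds hε))
  obtain ⟨K, hK⟩ := exists_eventually_const (m := m) (J := J)
    (fun k => (le_or_gt ((αs k - α) * ‖z (k + 1)‖) ε).imp (hstay k) (hmove k))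
    (fun k hk => hstay k (by
      rw [hαs k]
      exact (mul_le_mul_of_nonneg_left (hz _) (sub_nonneg.2 (ha.gt _).le)).trans (hJ _ hk).le))
  refine ⟨K, fun k hk => ⟨by rw [hαs, hαs, hK k hk], ?_⟩⟩
  by_contra! hcon
  have := hmove k hcon
  rw [hK k hk, hK (k + 1) (by lia)] at this
  lia

end IsAdaptiveDPFS

end AdaptiveDPFS

open AdaptiveDPFS

theorem mainTheorem3 {n p s : ℕ} (P : DCProgram n p s)
    -- the program
    (hS_ne : P.S.Nonempty) (hS_conv : Convex ℝ P.S) (hS_comp : IsCompact P.S)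
    (hf_proper : IsProper P.f) (hf_conv : IsConvexFun P.f) (hf_lsc : LowerSemicontinuous P.f)
    (hg_proper : IsProper P.g) (hg_conv : IsConvexFun P.g) (hg_lsc : LowerSemicontinuous P.g)
    (ℓ : ℝ≥0) (hphi : Differentiable ℝ P.phi) (hphi_lip : LipschitzWith ℓ (gradient P.phi))
    -- constraint qualifications and boundedness from below
    (hAS : P.A '' P.S ⊆ intrinsicInterior ℝ (effDom P.g))
    (hF : ⊥ < ⨅ x ∈ P.S, P.objective x)
    (hKS : P.K '' P.S ⊆ intrinsicInterior ℝ (effDom P.f))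
    (r : ℝ) (hr : 0 < r) (hKr : P.enlargement r ⊆ interior (effDom P.g))
    (L : ℝ≥0) (hL : 0 < L)
    (hg_lip : LipschitzOnWith L (fun v => (P.g v).toReal) (P.enlargement r))
    (hg_strict : IsEssStrictlyConvex P.g) (hf_int : (interior (effDom P.f)).Nonempty)
    -- the parameters
    (α γ μ ε : ℝ) (hα : 0 < α) (hαγ : α < γ / 2) (hγ : γ ≤ 2 * r / L) (hμ : 0 < μ)
    (hε : 0 < ε) (hεr : ε ≤ r)
    (a : ℕ → ℝ) (ha : IsParameterList α γ a)
    (αs βs ρs δs : ℕ → ℝ) (βlow βup : ℝ) (hβlow : 0 < βlow)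
    (hβ : ∀ k, βlow ≤ βs k ∧ βs k ≤ βup)
    -- the iterates
    (x : ℕ → EuclideanSpace ℝ (Fin n)) (y : ℕ → EuclideanSpace ℝ (Fin p))
    (z : ℕ → EuclideanSpace ℝ (Fin s)) (hz0 : ‖z 0‖ ≤ L)
    (halg : IsAdaptiveDPFS P ℓ α γ μ ε a αs βs ρs δs x y z) :
    ∃ (K₀ : ℕ) (αfin : ℝ), α < αfin ∧
      (∀ k, K₀ ≤ k → αs k = αfin ∧ (αs k - α) * ‖z (k + 1)‖ ≤ ε) ∧
      ∀ θ : ℝ, 0 ≤ θ → θ < 1 →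
        (∀ w : Space4 n p s, (limitingSubdiff (P.merit α αfin) w).Nonempty →
          ∃ σ : ℝ, 0 < σ ∧
            HasKLWith (P.merit α αfin) w (fun t : ℝ => σ / (1 - θ) * t ^ (1 - θ))) →
        ∃ (xbar : EuclideanSpace ℝ (Fin n)) (ybar : EuclideanSpace ℝ (Fin p))
          (zbar : EuclideanSpace ℝ (Fin s)),
          (Tendsto x atTop (𝓝 xbar) ∧ Tendsto y atTop (𝓝 ybar) ∧ Tendsto z atTop (𝓝 zbar)) ∧
          (θ = 0 → ∃ k₁ : ℕ, ∀ k, k₁ ≤ k → x k = xbar ∧ y k = ybar ∧ z k = zbar) ∧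
          (0 < θ → θ ≤ 1 / 2 → ∃ (K₁ : ℕ) (q κ : ℝ), K₀ + 2 ≤ K₁ ∧ 0 < q ∧ q < 1 ∧ 0 < κ ∧
            ∀ k, K₁ ≤ k →
              ‖x k - xbar‖ ≤ κ * q ^ k ∧ ‖y k - ybar‖ ≤ κ * q ^ k ∧ ‖z k - zbar‖ ≤ κ * q ^ k) ∧
          (1 / 2 < θ → ∃ (K₁ : ℕ) (κ : ℝ), K₀ + 2 ≤ K₁ ∧ 0 < κ ∧
            ∀ k : ℕ, K₁ ≤ k →
              ‖x k - xbar‖ ≤ κ * (k : ℝ) ^ (-((1 - θ) / (2 * θ - 1))) ∧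
              ‖y k - ybar‖ ≤ κ * (k : ℝ) ^ (-((1 - θ) / (2 * θ - 1))) ∧
              ‖z k - zbar‖ ≤ κ * (k : ℝ) ^ (-((1 - θ) / (2 * θ - 1)))) := by
  have hzL : ∀ k, ‖z k‖ ≤ L :=
    halg.norm_z_le hg_proper hg_conv hg_lsc hKr hL hg_lip hα hαγ hγ ha hz0
  obtain ⟨K₀, hK₀⟩ := halg.exists_final_parameter ha hε hzL
  refine ⟨K₀, αs K₀, halg.lt_αs ha K₀, hK₀, fun θ hθ0 hθ1 hKL => ?_⟩
  obtain ⟨c, hc⟩ : ∃ c, αs K₀ = α + c := ⟨αs K₀ - α, by ring⟩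
  have hc0 : 0 < c := by linarith [halg.lt_αs ha K₀]
  have hcγ : c ≤ γ := by
    obtain ⟨m, -, hm, -⟩ := halg.α_rule
    have := ha.le_add (m K₀)
    rw [← hm K₀, hc] at this
    linarith
  have hγ0 : 0 ≤ γ := by linarith
  have hρpos : ∀ k, 0 < ρs k := fun k => by rw [halg.ρ_rule k]; positivity
  have hρ : ∀ k, K₀ ≤ k → ρs k = ρs K₀ := fun k hk => by
    rw [halg.ρ_rule, halg.ρ_rule, (hK₀ k hk).1]
  have hβpos : ∀ k, 0 < βs k := fun k => hβlow.trans_le (hβ k).1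
  -- The index `K₀ + 1` rather than `K₀`, as `x 0` need not lie in `S`.
  have run : IsFixedParameterRun P α c (ρs K₀) L βs x y z (K₀ + 1) :=
    { mem := fun k hk => halg.x_mem (by lia)
      x_opt := fun k hk q hq => by
        rw [← hρ k (by lia)]
        exact halg.x_opt hS_conv (hρpos k) hq
      y_opt := fun k _ => halg.y_opt hf_proper hf_conv hf_lsc (hβpos k)
      z_opt := fun k hk => by
        rw [← hc, ← (hK₀ k (by lia)).1]
        exact halg.z_opt hg_proper hg_conv hg_lsc (hα.trans (halg.lt_αs ha k))
      norm_z_le := fun k _ => hzL k }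
  rw [intrinsicInterior_eq_interior hf_int] at hKS
  rw [hc] at hKL
  obtain ⟨xl, yl, zl, R, N', hlim, hR, hzero, hlin, hsub⟩ := run.exists_limit hS_comp hphi
    hphi_lip hg_proper hg_conv hg_lsc hg_strict hf_proper hf_conv hf_lsc hKS hα hc0 hcγ hαγ hμ
    (by rw [halg.ρ_rule, hc, add_sub_cancel_left]) hβlow hβ hθ0 hθ1 hKL
  refine ⟨xl, yl, zl, hlim, fun h0 => ?_, fun h0 h1 => ?_, fun h0 => ?_⟩
  · obtain ⟨k₁, hk₁⟩ := hzero h0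
    refine ⟨max N' k₁, fun k hk => ?_⟩
    have h := hR k (by lia)
    rw [hk₁ k (by lia)] at h
    simpa only [norm_le_zero_iff, sub_eq_zero] using h
  · obtain ⟨k₁, q, κ, hq0, hq1, hκ, hk₁⟩ := hlin h0 h1
    refine ⟨max (K₀ + 2) (max N' k₁), q, κ, le_max_left _ _, hq0, hq1, hκ, fun k hk => ?_⟩
    have h := hR k (by lia)
    have h' := hk₁ k (by lia)
    exact ⟨h.1.trans h', h.2.1.trans h', h.2.2.trans h'⟩
  · obtain ⟨k₁, κ, hκ, hk₁⟩ := hsub h0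
    refine ⟨max (K₀ + 2) (max N' k₁), κ, le_max_left _ _, hκ, fun k hk => ?_⟩
    have h := hR k (by lia)
    have h' := hk₁ k (by lia)
    exact ⟨h.1.trans h', h.2.1.trans h', h.2.2.trans h'⟩
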